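/- Let $\Omega=(0,1)^3$ and $\frac53\le p<2$. All fields are space-periodic with period $1$ in each coordinate; $\|\cdot\|_q$ is the norm of $L^q(\Omega)$, $\mathcal D u=\frac12(\nabla u+(\nabla u)^T)$, and $|\cdot|$ is the Euclidean norm on matrices. Let $\mathscr C_{\rm per}$ be the set of smooth, space-periodic, divergence-free fields $\Phi:\mathbb R^3\to\mathbb R^3$ with $\int_\Omega\Phi=0$, and let $J^{1,q}$ be its closure in the norm of $W^{1,q}(\Omega)$. For $f\in L^\infty(0,T;L^{4/p}(\Omega))$ and $v_0\in J^{1,2}$, a field $v$ is a solution on $(0,T)$ of the $p$-Navier–Stokes system $v_t+\operatorname{div}(v\otimes v)-\operatorname{div}(|\mathcal Dv|^{p-2}\mathcal Dv)+\nabla\pi=f$, $\operatorname{div}v=0$, with initial datum $v_0$, if $v\in C([0,T];J^{1,2})$, $\nabla^2v\in L^2(0,T;L^{4/(4-p)}(\Omega))$ (space-periodic), $v_t\in L^2((0,T)\times\Omega)$, $\lim_{t\to0^+}\|v(t)-v_0\|_2=0$, and for every $\omega\in J^{1,p}$, for a.e. $t\in(0,T)$, $$(v_t,\omega)+(v\cdot\nabla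 v,\omega)+(|\mathcal Dv|^{p-2}\mathcal Dv,\mathcal D\omega)=(f,\omega).$$ A function $u$ with values in a Banach space $X$ is time-periodic with period $\mathcal T$ if $\sup_{t\in[0,\mathcal T]}\|u(t)\|_X<\infty$ and $\|u(t+\mathcal T)-u(t)\|_X=0$ for all $t\ge0$. A number $C_S>0$ is called a Sobolev constant if $\|\Phi\|_2\le C_S\|\nabla\Phi\|_2$ and $\|\Phi\|_2^p\le C_S\|\mathcal D\Phi\|_p^p$ for all $\Phi\in\mathscr C_{\rm per}$. **Theorem 3 (extinction).** Sobolev constants exist. Moreover, let $C_S$ be a Sobolev constant, $C_K>0$, and let $\Lambda>0$, $K\ge0$ satisfy $$\Lambda<\min\Big\{\big(\tfrac{p}{8C_S}\big)^{\frac2{3-p}},\ \big(\tfrac{3^{(2-p)/2}C_SC_K}{2}\big)^{-\frac2{3-p}},\ \big(C_S^{-1}C_K^{-1}3^{\frac{p-2}2}(p-1)\big)^{\frac2{3-p}}\Big\},\qquad C_SK^2\,2^{2-p}\le\frac{p(p-1)}8\Lambda^{p-1}.$$ Let $f\in L^\infty(0,\infty;L^{4/p}(\Omega))$ be time-periodic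 with period $\mathcal T$ and $\operatorname{ess\,sup}_{t\ge0}\|f(t)\|_{4/p}\le K$, and let $v$ be a time-periodic field with period $\mathcal T$ that, for some $v_0\in J^{1,2}$, is a solution on $(0,T)$ with force $f$ and initial datum $v_0$ for every $T>0$ and satisfies $\sup_{t\in[0,\mathcal T]}\|\nabla v(t)\|_2^2\le\Lambda$. If there is $t_f\in(0,\mathcal T)$ with $\|f(t)\|_{4/p}=0$ for a.e. $t\in[t_f,\mathcal T]$ and $$t_f+\frac{C_S^{3-p}\Lambda^{(2-p)/2}}{2-p}<\mathcal T,$$ then there is an instant $\bar t$ with $t_f\le\bar t\le t_f+\frac{C_S^{3-p}\Lambda^{(2-p)/2}}{2-p}$ such that $\|v(t)\|_2=0$ for all $t\in[\bar t,\mathcal T]$. -/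

import Mathlib

open MeasureTheory Set Filter Topology
open scoped ENNReal ContDiff

noncomputable section

namespace PNavierStokes

/-- Three dimensional Euclidean space. -/
abbrev V : Type := EuclideanSpace ℝ (Fin 3)

/-- Real `3 × 3` matrices with the Euclidean (Frobenius) norm; `inner ℝ A B` is `A : B`. -/
abbrev M : Type := EuclideanSpace ℝ (Fin 3 × Fin 3)

/-- Real `3 × 3 × 3` tensors with the Euclidean norm. -/
abbrev M₃ : Type := EuclideanSpace ℝ (Fin 3 × Fin 3 × Fin 3)

/-- The unit cube `(0,1)³`. -/
def cube : Set V := {x | ∀ i, x i ∈ Ioo (0 : ℝ) 1}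

/-- Lebesgue measure on the unit cube. -/
def cubeMeasure : Measure V := volume.restrict cube

/-- The canonical basis vectors. -/
def e (i : Fin 3) : V := EuclideanSpace.single i (1 : ℝ)

/-- Space periodicity with period `1` in each coordinate. -/
def IsSpacePeriodic {F : Type*} (g : V → F) : Prop := ∀ i x, g (x + e i) = g x

/-- The gradient `(∇Φ)ᵢⱼ = ∂ⱼ Φᵢ` of a differentiable vector field. -/
def grad (Φ : V → V) (x : V) : M := WithLp.toLp 2 fun ij => fderiv ℝ Φ x (e ij.2) ij.1

/-- The symmetric part of a matrix. -/
def symPart (A : M) : M := WithLp.toLp 2 fun ij => (A (ij.1, ij.2) + A (ij.2, ij.1)) / 2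

/-- The class `𝒞_per(Ω)`: smooth space-periodic solenoidal vector fields of zero mean value. -/
structure IsSmoothSolenoidal (Φ : V → V) : Prop where
  smooth : ContDiff ℝ ∞ Φ
  periodic : IsSpacePeriodic Φ
  mean_zero : ∫ x, Φ x ∂cubeMeasure = 0
  div_zero : ∀ x, ∑ i, grad Φ x (i, i) = 0

/-- The ambient space for pairs `(u, ∇u)` with `u` and `∇u` in `L^q` of the cube. The topology is
the one of the norm of `W^{1,q}`. -/
abbrev W (q : ℝ≥0∞) : Type := Lp V q cubeMeasure × Lp M q cubeMeasure

/-- The space `J^{1,q}_per(Ω)`: the closure of the smooth space-periodic solenoidal fields of zero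
mean value in the norm of `W^{1,q}`. An element is recorded as the pair of a field and of its weak
gradient. -/
def J (q : ℝ≥0∞) [Fact (1 ≤ q)] : Set (W q) :=
  closure {u | ∃ Φ : V → V, IsSmoothSolenoidal Φ ∧
    u.1 =ᵐ[cubeMeasure] Φ ∧ u.2 =ᵐ[cubeMeasure] grad Φ}

/-- `H` is the weak gradient, as a space-periodic distribution, of the matrix field `G`, that is
`Hᵢⱼₖ = ∂ₖ Gᵢⱼ`. -/
def HasPeriodicWeakGrad (G : V → M) (H : V → M₃) : Prop :=
  ∀ φ : V → ℝ, ContDiff ℝ ∞ φ → IsSpacePeriodic φ → ∀ i j k,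
    ∫ x, G x (i, j) * fderiv ℝ φ x (e k) ∂cubeMeasure = -∫ x, H x (i, j, k) * φ x ∂cubeMeasure

/-- `w` is the weak derivative of `u` on the time interval `(0,T)`. -/
def HasWeakTimeDeriv (T : ℝ) (u w : ℝ → Lp V 2 cubeMeasure) : Prop :=
  ∀ η : ℝ → ℝ, ContDiff ℝ ∞ η → HasCompactSupport η → tsupport η ⊆ Ioo 0 T →
    ∫ t in Ioo 0 T, deriv η t • u t = -∫ t in Ioo 0 T, η t • w t

/-- The stress tensor `S(A) = |A|^{p-2} A`, with `S(0) = 0`. -/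
def stress (p : ℝ) (A : M) : M := ‖A‖ ^ (p - 2) • A

/-- The convective term `(v·∇v)ᵢ = ∑ⱼ vⱼ ∂ⱼvᵢ`, as a function of `v` and `G = ∇v`. -/
def convect (v : V) (G : M) : V := WithLp.toLp 2 fun i => ∑ j, v j * G (i, j)

/-- A time-periodic function with period `𝒯` and with values in the normed space `X`. -/
def IsTimePeriodic {X : Type*} [NormedAddCommGroup X] (𝒯 : ℝ) (u : ℝ → X) : Prop :=
  BddAbove ((fun t => ‖u t‖) '' Icc 0 𝒯) ∧ ∀ t, 0 ≤ t → ‖u (t + 𝒯) - u t‖ = 0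

instance (p : ℝ) [h : Fact (p ∈ Ico (5 / 3 : ℝ) 2)] : Fact (1 ≤ ENNReal.ofReal p) :=
  ⟨by
    have := h.out.1
    exact ENNReal.one_le_ofReal.2 (by linarith)⟩

instance (p : ℝ) [h : Fact (p ∈ Ico (5 / 3 : ℝ) 2)] : Fact (1 ≤ ENNReal.ofReal (4 / p)) :=
  ⟨by
    have h1 := h.out.1
    have h2 := h.out.2
    exact ENNReal.one_le_ofReal.2 ((one_le_div (by linarith)).2 (by linarith))⟩

instance (p : ℝ) [h : Fact (p ∈ Ico (5 / 3 : ℝ) 2)] : Fact (1 ≤ ENNReal.ofReal (4 / (4 - p))) :=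
  ⟨by
    have h1 := h.out.1
    have h2 := h.out.2
    exact ENNReal.one_le_ofReal.2 ((one_le_div (by linarith)).2 (by linarith))⟩

/-- `v` (with `(v t).1` the field at time `t` and `(v t).2` its spatial gradient) is a solution on
`(0,T)` of the space-periodic `p`-Navier-Stokes system with force `f` and initial datum `v₀`. -/
structure IsSolutionOn (p : ℝ) [Fact (p ∈ Ico (5 / 3 : ℝ) 2)] (T : ℝ)
    (f : ℝ → Lp V (ENNReal.ofReal (4 / p)) cubeMeasure) (v₀ : W 2) (v : ℝ → W 2) : Prop where
  force_mem : MemLp f ∞ (volume.restrict (Ioo 0 T))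
  init_mem : v₀ ∈ J 2
  mem : ∀ t ∈ Icc 0 T, v t ∈ J 2
  continuousOn : ContinuousOn v (Icc 0 T)
  /-- `∇²v ∈ L²(0,T; L^{4/(4-p)}(Ω))`. -/
  second_deriv : ∃ H : ℝ → Lp M₃ (ENNReal.ofReal (4 / (4 - p))) cubeMeasure,
    MemLp H 2 (volume.restrict (Ioo 0 T)) ∧
    ∀ᵐ t ∂volume.restrict (Ioo 0 T), HasPeriodicWeakGrad (v t).2 (H t)
  /-- `v_t ∈ L²(Ω_T)`, and the equation holds. -/
  equation : ∃ w : ℝ → Lp V 2 cubeMeasure,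
    MemLp w 2 (volume.restrict (Ioo 0 T)) ∧
    HasWeakTimeDeriv T (fun t => (v t).1) w ∧
    ∀ ψ ∈ J (ENNReal.ofReal p), ∀ᵐ t ∂volume.restrict (Ioo 0 T),
      (∫ x, inner ℝ (w t x) (ψ.1 x) ∂cubeMeasure)
        + (∫ x, inner ℝ (convect ((v t).1 x) ((v t).2 x)) (ψ.1 x) ∂cubeMeasure)
        + (∫ x, inner ℝ (stress p (symPart ((v t).2 x))) (symPart (ψ.2 x)) ∂cubeMeasure)
        = ∫ x, inner ℝ (f t x) (ψ.1 x) ∂cubeMeasure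
  initial : Tendsto (fun t => ‖(v t).1 - v₀.1‖) (𝓝[>] 0) (𝓝 0)

/-- `C` is a common constant for the Poincaré inequality `‖Φ‖₂ ≤ C ‖∇Φ‖₂` and for the
Sobolev-Korn inequality `‖Φ‖₂^p ≤ C ‖DΦ‖_p^p` on the smooth space-periodic solenoidal fields of
zero mean value. -/
structure IsSobolevConstant (p C : ℝ) : Prop where
  pos : 0 < C
  poincare : ∀ Φ : V → V, IsSmoothSolenoidal Φ →
    eLpNorm Φ 2 cubeMeasure ≤ ENNReal.ofReal C * eLpNorm (grad Φ) 2 cubeMeasure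
  sobolev : ∀ Φ : V → V, IsSmoothSolenoidal Φ →
    eLpNorm Φ 2 cubeMeasure ^ p ≤ ENNReal.ofReal C *
      eLpNorm (fun x => symPart (grad Φ x)) (ENNReal.ofReal p) cubeMeasure ^ p

/-- The smallness conditions on the constants `Λ` and `K`. -/
structure IsSmall (p C_S C_K Λ K : ℝ) : Prop where
  Λ_pos : 0 < Λ
  K_nonneg : 0 ≤ K
  Λ_lt : Λ < min ((p / (8 * C_S)) ^ (2 / (3 - p)))
    (min (((3 : ℝ) ^ ((2 - p) / 2) * C_S * C_K / 2) ^ (-(2 / (3 - p))))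
      ((C_S⁻¹ * C_K⁻¹ * (3 : ℝ) ^ ((p - 2) / 2) * (p - 1)) ^ (2 / (3 - p))))
  K_le : C_S * K ^ 2 * (2 : ℝ) ^ (2 - p) ≤ p * (p - 1) / 8 * Λ ^ (p - 1)

end PNavierStokes

end

open PNavierStokes

noncomputable section

namespace PNavierStokes

open scoped ComplexConjugate

/-! Extinction comes from the energy balance. Where the force vanishes, testing the equation with
`v` itself removes the convective term and gives d/dt ‖v‖₂² = -2 ‖Dv‖_p^p. The Sobolev-Korn
inequality turns this into C_S y' ≤ -2 y^(p/2) for y = ‖v‖₂². Since p/2 < 1, y^((2-p)/2) decreases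
at least at the constant rate (2-p)/C_S while y is positive, so y reaches zero in finite time
(`eq_zero_of_deriv_le`). Poincaré and the gradient bound at t_f give y(t_f) ≤ C_S² Λ, and hence the
stated waiting time.

Two points need work. The first is the existence of Sobolev constants. Everything rests on the
embedding of L^(4/3) into the homogeneous space H^(-1), proved with Fourier series: the multiplier
|k|^(-2) is square summable on ℤ³, so its kernel is in L² and a Young inequality applies
(`sum_mul_fcoeff_sq_le`). For a solenoidal field, the divergence of the symmetric gradient is half
the Laplacian, so the field is recovered from its symmetric gradient by an operator of order -1;
this yields ‖Φ‖₂ ≤ C ‖DΦ‖_q for all q ≥ 4/3. By duality, the same embedding bounds the L⁴ norm by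
‖∇Φ‖₂.

The second is the energy equality. For a fixed test field the equation holds only for almost every
time, with a null set depending on that field, so `v(t)` cannot be inserted directly. But the
convective and stress forms are jointly continuous on J^(1,2): the former by the L⁴ embedding, the
latter because the stress is Hölder continuous of exponent p-1. Hence ⟨v(t), ψ⟩ is differentiable at
every time for each fixed ψ (`hasDerivAt_of_weak`), and joint continuity allows ψ to be replaced by
the solution (`hasDerivAt_norm_sq`). Identities and inequalities for the forms pass from smooth
fields to J^(1,2) by density. -/

instance : IsProbabilityMeasure cubeMeasure := by
  constructor
  have h : cube = (MeasurableEquiv.toLp 2 (Fin 3 → ℝ)).symm ⁻¹'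
      (Set.univ.pi fun _ => Ioo (0 : ℝ) 1) := by
    ext x; simp [cube]
  rw [cubeMeasure, Measure.restrict_apply_univ, h,
    (EuclideanSpace.volume_preserving_symm_measurableEquiv_toLp (Fin 3)).measure_preimage
      (MeasurableSet.univ_pi fun _ => measurableSet_Ioo).nullMeasurableSet, Real.volume_pi_Ioo]
  simp

/-! ### Integration over the cube and over periods -/

theorem measurableSet_cube : MeasurableSet cube := by
  have h : cube = ⋂ i : Fin 3, (fun x : V => x i) ⁻¹' Ioo 0 1 := by
    ext x; simp [cube]
  rw [h]
  exact MeasurableSet.iInter fun i =>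
    (EuclideanSpace.proj i : V →L[ℝ] ℝ).continuous.measurable measurableSet_Ioo

theorem isBounded_cube : Bornology.IsBounded cube := by
  refine (Metric.isBounded_closedBall (x := (0 : V)) (r := 3)).subset fun x hx => ?_
  rw [mem_closedBall_zero_iff, EuclideanSpace.norm_eq]
  refine Real.sqrt_le_iff.2 ⟨by norm_num, ?_⟩
  rw [Fin.sum_univ_three]
  have h := fun i => hx i
  have h1 : ∀ i, ‖x i‖ ^ 2 ≤ 1 := fun i => by
    rw [Real.norm_eq_abs, sq_abs]; nlinarith [(hx i).1, (hx i).2]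
  linarith [h1 0, h1 1, h1 2]

/-- A continuous function is bounded on the cube. -/
theorem exists_bound_cube {E : Type*} [SeminormedAddCommGroup E] {g : V → E} (hg : Continuous g) :
    ∃ C : ℝ, ∀ᵐ x ∂cubeMeasure, ‖g x‖ ≤ C := by
  obtain ⟨C, hC⟩ := isBounded_cube.isCompact_closure.exists_bound_of_continuousOn hg.continuousOn
  exact ⟨C, (ae_restrict_iff' measurableSet_cube).2 (.of_forall fun x hx => hC x (subset_closure hx))⟩

theorem memLp_cube {E : Type*} [NormedAddCommGroup E] [SecondCountableTopology E] {g : V → E}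
    (hg : Continuous g) (q : ℝ≥0∞) : MemLp g q cubeMeasure := by
  obtain ⟨C, hC⟩ := exists_bound_cube hg
  exact MemLp.of_bound hg.aestronglyMeasurable C hC

theorem integrable_cube {E : Type*} [NormedAddCommGroup E] [SecondCountableTopology E] {g : V → E}
    (hg : Continuous g) : Integrable g cubeMeasure :=
  memLp_one_iff_integrable.1 (memLp_cube hg 1)

/-- The integral over the cube as an integral over a box in `Fin 3 → ℝ`. -/
theorem integral_cube_eq {E : Type*} [NormedAddCommGroup E] [NormedSpace ℝ E] (g : V → E) :
    ∫ x, g x ∂cubeMeasure = ∫ x in Icc (0 : Fin 3 → ℝ) 1, g (WithLp.toLp 2 x) := by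
  have h : cube = (MeasurableEquiv.toLp 2 (Fin 3 → ℝ)).symm ⁻¹'
      (Set.univ.pi fun _ => Ioo (0 : ℝ) 1) := by
    ext x; simp [cube]
  have h2 := (EuclideanSpace.volume_preserving_symm_measurableEquiv_toLp
    (Fin 3)).setIntegral_preimage_emb (MeasurableEquiv.measurableEmbedding _)
    (fun x => g (WithLp.toLp 2 x)) (Set.univ.pi fun _ => Ioo (0 : ℝ) 1)
  rw [cubeMeasure, h]
  refine Eq.trans ?_ (h2.trans ?_)
  · rfl
  · exact setIntegral_congr_set (Measure.univ_pi_Ioo_ae_eq_Icc (f := (0 : Fin 3 → ℝ)) (g := 1))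

/-- The integral over the cube of a derivative of a periodic function vanishes. -/
theorem integral_fderiv_eq_zero {E : Type*} [NormedAddCommGroup E] [NormedSpace ℝ E]
    [SecondCountableTopology E]
    {h : V → E} (hh : ContDiff ℝ 1 h) (hp : IsSpacePeriodic h) (j : Fin 3) :
    ∫ x, fderiv ℝ h x (e j) ∂cubeMeasure = 0 := by
  let eL : (Fin 3 → ℝ) ≃L[ℝ] V := (EuclideanSpace.equiv (Fin 3) ℝ).symm
  have heL : ∀ x, eL x = WithLp.toLp 2 x := fun x => rfl
  have hcd : ContDiff ℝ 1 (h ∘ eL) := hh.comp eL.contDiff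
  have hd : ∀ x, HasFDerivAt (h ∘ eL) ((fderiv ℝ h (eL x)).comp (eL : (Fin 3 → ℝ) →L[ℝ] V)) x :=
    fun x => ((hh.differentiable (by norm_num)) (eL x)).hasFDerivAt.comp x eL.hasFDerivAt
  have hcont : Continuous fun x => fderiv ℝ h (eL x) (e j) :=
    ((hh.continuous_fderiv (by norm_num)).comp eL.continuous).clm_apply continuous_const
  have hsum : ∀ x, (∑ i, (if i = j then (fderiv ℝ h (eL x)).comp (eL : (Fin 3 → ℝ) →L[ℝ] V) else 0)
      (Pi.single i 1)) = fderiv ℝ h (eL x) (e j) := by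
    intro x
    rw [Finset.sum_eq_single j]
    · simp [e, heL]
    · intro i _ hi; simp [hi]
    · simp
  -- Divergence theorem for the field whose only nonzero component is `h` in direction `j`;
  -- periodicity makes the two opposite faces cancel.
  have key := integral_divergence_of_hasFDerivAt_off_countable' (0 : Fin 3 → ℝ) 1
    (by intro i; simp) (fun i x => if i = j then h (eL x) else 0)
    (fun i x => if i = j then (fderiv ℝ h (eL x)).comp (eL : (Fin 3 → ℝ) →L[ℝ] V) else 0)
    ∅ countable_empty
    (by
      intro i
      split_ifs
      · exact (hh.continuous.comp eL.continuous).continuousOn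
      · exact continuousOn_const)
    (by
      intro x _ i
      split_ifs
      · exact hd x
      · exact hasFDerivAt_const _ _)
    (by
      simp only [hsum]
      exact hcont.continuousOn.integrableOn_compact isCompact_Icc)
  simp only [hsum] at key
  rw [integral_cube_eq]
  simp only [← heL]
  rw [key]
  refine Finset.sum_eq_zero fun i _ => ?_
  rw [sub_eq_zero]
  congr 1
  ext x
  split_ifs
  · have : eL (i.insertNth ((1 : Fin 3 → ℝ) i) x) = eL (i.insertNth ((0 : Fin 3 → ℝ) i) x) + e i := by
      ext l
      simp only [heL, e, PiLp.add_apply]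
      refine Fin.succAboveCases i ?_ ?_ l
      · simp
      · intro l; simp
    rw [this, hp]
  · rfl

/-! ### Fourier series on the cube -/

/-- The phase `2πi k·x` as a real linear function of `x`. -/
def phase (k : Fin 3 → ℤ) : V →L[ℝ] ℂ :=
  ∑ i, (2 * Real.pi * Complex.I * (k i : ℂ)) • Complex.ofRealCLM.comp (EuclideanSpace.proj i)

theorem phase_apply (k : Fin 3 → ℤ) (x : V) :
    phase k x = ∑ i, 2 * Real.pi * Complex.I * (k i : ℂ) * (x i : ℂ) := by
  simp [phase]

theorem phase_e (k : Fin 3 → ℤ) (j : Fin 3) :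
    phase k (e j) = 2 * Real.pi * Complex.I * (k j : ℂ) := by
  rw [phase_apply, Finset.sum_eq_single j]
  · simp [e]
  · intro i _ hi; simp [e, hi]
  · simp

/-- The character `exp (2πi k·x)`. -/
def chi (k : Fin 3 → ℤ) (x : V) : ℂ := Complex.exp (phase k x)

/-- The Fourier coefficients of a function on the cube. -/
def fcoeff (g : V → ℂ) (k : Fin 3 → ℤ) : ℂ := ∫ x, conj (chi k x) * g x ∂cubeMeasure

theorem contDiff_chi (k : Fin 3 → ℤ) : ContDiff ℝ ∞ (chi k) :=
  (Complex.contDiff_exp (𝕜 := ℝ)).comp (phase k).contDiff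

theorem continuous_chi (k : Fin 3 → ℤ) : Continuous (chi k) := (contDiff_chi k).continuous

theorem conj_phase (k : Fin 3 → ℤ) (x : V) : conj (phase k x) = - phase k x := by
  simp [phase_apply, Complex.conj_ofNat]

theorem conj_chi (k : Fin 3 → ℤ) (x : V) : conj (chi k x) = chi (-k) x := by
  rw [chi, chi, ← Complex.exp_conj, conj_phase]
  congr 1
  simp [phase_apply]

theorem norm_chi (k : Fin 3 → ℤ) (x : V) : ‖chi k x‖ = 1 := by
  have h : ‖chi k x‖ ^ 2 = 1 := by
    have h1 := Complex.mul_conj' (chi k x)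
    rw [chi, ← Complex.exp_conj, conj_phase, ← Complex.exp_add, add_neg_cancel,
      Complex.exp_zero] at h1
    exact_mod_cast h1.symm
  nlinarith [norm_nonneg (chi k x)]

theorem isSpacePeriodic_chi (k : Fin 3 → ℤ) : IsSpacePeriodic (chi k) := by
  intro i x
  rw [chi, chi, map_add, Complex.exp_add, phase_e]
  have : Complex.exp (2 * Real.pi * Complex.I * (k i : ℂ)) = 1 := by
    rw [Complex.exp_eq_one_iff]; exact ⟨k i, by ring⟩
  rw [this, mul_one]

theorem fderiv_chi (k : Fin 3 → ℤ) (x : V) (j : Fin 3) :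
    fderiv ℝ (chi k) x (e j) = 2 * Real.pi * Complex.I * (k j : ℂ) * chi k x := by
  have h : HasFDerivAt (chi k) (Complex.exp (phase k x) • (phase k)) x :=
    (phase k).hasFDerivAt.cexp
  rw [h.fderiv, smul_apply, phase_e, smul_eq_mul, mul_comm, chi]

/-- Fourier coefficients of a partial derivative. -/
theorem fcoeff_fderiv {g : V → ℂ} (hg : ContDiff ℝ 1 g) (hp : IsSpacePeriodic g)
    (k : Fin 3 → ℤ) (j : Fin 3) :
    fcoeff (fun x => fderiv ℝ g x (e j)) k = 2 * Real.pi * Complex.I * (k j : ℂ) * fcoeff g k := by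
  have hc : ContDiff ℝ 1 (chi (-k)) := (contDiff_chi _).of_le (by simp)
  -- Integration by parts: the product of the conjugate character and `g` is periodic, so the
  -- integral of its derivative vanishes.
  have h0 : ∫ x, fderiv ℝ (chi (-k) * g) x (e j) ∂cubeMeasure = 0 :=
    integral_fderiv_eq_zero (hc.mul hg)
    (fun i x => by simp only; rw [isSpacePeriodic_chi, hp]) j
  have h1 : ∀ x, fderiv ℝ (chi (-k) * g) x (e j) = conj (chi k x) * fderiv ℝ g x (e j)
      - 2 * Real.pi * Complex.I * (k j : ℂ) * (conj (chi k x) * g x) := by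
    intro x
    rw [fderiv_mul (hc.differentiable (by norm_num) x) (hg.differentiable (by norm_num) x)]
    simp only [add_apply, smul_apply, smul_eq_mul,
      fderiv_chi, conj_chi, Pi.neg_apply, Int.cast_neg]
    ring
  have hi1 : Integrable (fun x => conj (chi k x) * fderiv ℝ g x (e j)) cubeMeasure :=
    integrable_cube ((Complex.continuous_conj.comp (continuous_chi k)).mul
      ((hg.continuous_fderiv (by norm_num)).clm_apply continuous_const))
  have hi2 : Integrable (fun x => conj (chi k x) * g x) cubeMeasure :=
    integrable_cube ((Complex.continuous_conj.comp (continuous_chi k)).mul hg.continuous)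
  simp only [h1] at h0
  rw [integral_sub hi1 (hi2.const_mul _), integral_const_mul, sub_eq_zero] at h0
  exact h0

theorem integral_chi_of_ne {k : Fin 3 → ℤ} (hk : k ≠ 0) : ∫ x, chi k x ∂cubeMeasure = 0 := by
  obtain ⟨j, hj⟩ := Function.ne_iff.1 hk
  have h := integral_fderiv_eq_zero ((contDiff_chi k).of_le (by simp)) (isSpacePeriodic_chi k) j
  simp only [fderiv_chi] at h
  rw [integral_const_mul, mul_eq_zero] at h
  refine h.resolve_left ?_
  have : (k j : ℂ) ≠ 0 := by exact_mod_cast hj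
  simp [Real.pi_ne_zero, this]

theorem fcoeff_chi (k l : Fin 3 → ℤ) : fcoeff (chi l) k = if k = l then 1 else 0 := by
  have h : ∀ x, conj (chi k x) * chi l x = chi (l - k) x := by
    intro x
    rw [conj_chi, chi, chi, chi, ← Complex.exp_add]
    congr 1
    simp only [phase_apply, ← Finset.sum_add_distrib]
    refine Finset.sum_congr rfl fun i _ => ?_
    simp; ring
  simp only [fcoeff, h]
  split_ifs with hkl
  · simp [hkl, chi, phase_apply]
  · exact integral_chi_of_ne (sub_ne_zero.2 (Ne.symm hkl))

section Torus

local instance : MeasureSpace UnitAddCircle := ⟨AddCircle.haarAddCircle⟩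

/-- Transfers Fourier analysis from the torus to the cube. The section takes values in the half-open
cube (0,1]³, which differs from the open cube by a null set. -/
theorem exists_torus_section : ∃ s : UnitAddTorus (Fin 3) → V,
    MeasurePreserving s volume cubeMeasure ∧
      ∀ k θ, chi k (s θ) = UnitAddTorus.mFourier k θ := by
  have h1 := UnitAddTorus.measurePreserving_equivPiIoc (d := Fin 3) 0
  set A : Set (Fin 3 → ℝ) := {x | ∀ i, x i ∈ Ioc ((0 : Fin 3 → ℝ) i) ((0 : Fin 3 → ℝ) i + 1)}
    with hA
  have hAe : A = Set.univ.pi fun i => Ioc ((0 : Fin 3 → ℝ) i) ((1 : Fin 3 → ℝ) i) := by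
    ext x; simp [hA]
  have hAm : MeasurableSet A := by
    rw [hAe]; exact MeasurableSet.univ_pi fun _ => measurableSet_Ioc
  have h2 : MeasurePreserving (Subtype.val : A → Fin 3 → ℝ) (Measure.comap Subtype.val volume)
      (volume.restrict A) := measurePreserving_subtype_coe hAm
  have hB : volume.restrict A = volume.restrict (Set.univ.pi fun _ : Fin 3 => Ioo (0 : ℝ) 1) := by
    rw [hAe]
    refine Measure.restrict_congr_set ?_
    exact Measure.univ_pi_Ioc_ae_eq_Icc.trans Measure.univ_pi_Ioo_ae_eq_Icc.symm
  have h3 : MeasurePreserving (MeasurableEquiv.toLp 2 (Fin 3 → ℝ)) (volume.restrict A)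
      cubeMeasure := by
    have := (EuclideanSpace.volume_preserving_symm_measurableEquiv_toLp (Fin 3)).symm
      |>.restrict_preimage measurableSet_cube
    rw [hB, cubeMeasure]
    have hc : (MeasurableEquiv.toLp 2 (Fin 3 → ℝ)).symm.symm ⁻¹' cube =
        Set.univ.pi fun _ : Fin 3 => Ioo (0 : ℝ) 1 := by
      ext x; simp [cube]
    rw [hc] at this
    exact this
  refine ⟨_, h3.comp (h2.comp h1), fun k θ => ?_⟩
  have h4 : ∀ i, ((AddCircle.equivIoc (1 : ℝ) 0 (θ i)).1 : UnitAddCircle) = θ i := fun i =>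
    (AddCircle.equivIoc (1 : ℝ) 0).symm_apply_apply (θ i)
  simp only [UnitAddTorus.mFourier, ContinuousMap.coe_mk, Function.comp_apply, chi, phase_apply,
    Complex.exp_sum]
  refine Finset.prod_congr rfl fun i _ => ?_
  conv_rhs => rw [← h4 i, fourier_coe_apply]
  congr 1
  simp

/-- Parseval's identity on the cube. -/
theorem hasSum_fcoeff {g h : V → ℂ} (hg : MemLp g 2 cubeMeasure) (hh : MemLp h 2 cubeMeasure) :
    HasSum (fun k => conj (fcoeff g k) * fcoeff h k) (∫ x, conj (g x) * h x ∂cubeMeasure) := by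
  obtain ⟨s, hs, hchi⟩ := exists_torus_section
  have hint : ∀ F : V → ℂ, AEStronglyMeasurable F cubeMeasure →
      ∫ x, F x ∂cubeMeasure = ∫ θ, F (s θ) := by
    intro F hF
    rw [← hs.map_eq] at hF ⊢
    exact integral_map hs.measurable.aemeasurable hF
  have hco : ∀ g : V → ℂ, (hg : MemLp g 2 cubeMeasure) → ∀ k,
      UnitAddTorus.mFourierCoeff ((hg.comp_measurePreserving hs).toLp) k = fcoeff g k := by
    intro g hg k
    rw [fcoeff, hint (fun x => conj (chi k x) * g x) ((Complex.continuous_conj.comp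
      (continuous_chi k)).aestronglyMeasurable.mul hg.1), UnitAddTorus.mFourierCoeff]
    refine integral_congr_ae ?_
    filter_upwards [(hg.comp_measurePreserving hs).coeFn_toLp] with θ hθ
    rw [hθ, conj_chi, hchi, smul_eq_mul, Function.comp_apply]
  have key := UnitAddTorus.hasSum_prod_mFourierCoeff (hg.comp_measurePreserving hs).toLp
    (hh.comp_measurePreserving hs).toLp
  simp only [hco g hg, hco h hh] at key
  convert key using 1
  rw [hint (fun x => conj (g x) * h x) ((Complex.continuous_conj.comp_aestronglyMeasurable hg.1).mul hh.1)]
  refine integral_congr_ae ?_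
  filter_upwards [(hg.comp_measurePreserving hs).coeFn_toLp,
    (hh.comp_measurePreserving hs).coeFn_toLp] with θ h1 h2
  rw [h1, h2]; rfl

end Torus

theorem hasSum_norm_fcoeff_sq {g : V → ℂ} (hg : MemLp g 2 cubeMeasure) :
    HasSum (fun k => ‖fcoeff g k‖ ^ 2) (∫ x, ‖g x‖ ^ 2 ∂cubeMeasure) := by
  have h := Complex.hasSum_re (hasSum_fcoeff hg hg)
  have hi : Integrable (fun x => conj (g x) * g x) cubeMeasure :=
    MemLp.integrable_mul (p := 2) (q := 2) hg.star hg
  simp only [Complex.conj_mul'] at h hi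
  have h2 : (∫ x, (‖g x‖ : ℂ) ^ 2 ∂cubeMeasure) = ((∫ x, ‖g x‖ ^ 2 ∂cubeMeasure : ℝ) : ℂ) := by
    rw [← integral_complex_ofReal]; simp
  rw [h2] at h
  norm_cast at h

/-- Parseval's identity for trigonometric polynomials. -/
theorem integral_norm_sum_chi_sq (S : Finset (Fin 3 → ℤ)) (a : (Fin 3 → ℤ) → ℂ) :
    ∫ x, ‖∑ k ∈ S, a k * chi k x‖ ^ 2 ∂cubeMeasure = ∑ k ∈ S, ‖a k‖ ^ 2 := by
  have hcont : Continuous fun x => ∑ k ∈ S, a k * chi k x :=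
    continuous_finsetSum _ fun k _ => continuous_const.mul (continuous_chi k)
  have h := hasSum_norm_fcoeff_sq (memLp_cube hcont 2)
  have hc : ∀ l, fcoeff (fun x => ∑ k ∈ S, a k * chi k x) l = if l ∈ S then a l else 0 := by
    intro l
    have : ∀ x, conj (chi l x) * ∑ k ∈ S, a k * chi k x
        = ∑ k ∈ S, a k * (conj (chi l x) * chi k x) := fun x => by
      rw [Finset.mul_sum]; exact Finset.sum_congr rfl fun k _ => by ring
    rw [fcoeff]
    simp only [this]
    rw [integral_finsetSum]
    · simp only [integral_const_mul]
      have h2 : ∀ k, ∫ x, conj (chi l x) * chi k x ∂cubeMeasure = if l = k then 1 else 0 :=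
        fun k => fcoeff_chi l k
      simp [h2]
    · intro k _
      exact (integrable_cube ((Complex.continuous_conj.comp (continuous_chi l)).mul
        (continuous_chi k))).const_mul _
  simp only [hc] at h
  have h2 := hasSum_sum_of_ne_finset_zero (s := S) (L := .unconditional _)
    (f := fun k => ‖if k ∈ S then a k else 0‖ ^ 2) (fun k hk => by simp [hk])
  rw [h.unique h2]
  exact Finset.sum_congr rfl fun k hk => by simp [hk]

/-! ### The embedding of L^(4/3) into H^(-1) -/

theorem integrable_cube_prod {E : Type*} [NormedAddCommGroup E] [SecondCountableTopology E]
    {g : V × V → E} (hg : Continuous g) : Integrable g (cubeMeasure.prod cubeMeasure) := by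
  have hK := isBounded_cube.isCompact_closure
  obtain ⟨C, hC⟩ := (hK.prod hK).exists_bound_of_continuousOn hg.continuousOn
  refine Integrable.of_bound hg.aestronglyMeasurable C ?_
  rw [cubeMeasure, Measure.prod_restrict]
  exact (ae_restrict_iff' (measurableSet_cube.prod measurableSet_cube)).2
    (.of_forall fun x hx => hC x ⟨subset_closure hx.1, subset_closure hx.2⟩)

/-- Pointwise form of Young's inequality for a kernel. Write K a b as the product of (ab)^(2/3) and
(ab)^(1/3) K, apply the weighted AM-GM inequality, then bound (ab)^(2/3) by the mean of a^(4/3) and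
b^(4/3). After integration only ∫ |g|^(4/3) and the L² norms of the slices of the kernel survive. -/
theorem kernel_mul_le {K a b l : ℝ} (ha : 0 ≤ a) (hb : 0 ≤ b) (hl : 0 < l) :
    K * a * b ≤ l / 2 * (a ^ (4 / 3 : ℝ) * b ^ (4 / 3 : ℝ))
      + (4 * l)⁻¹ * (a ^ (4 / 3 : ℝ) * K ^ 2 + b ^ (4 / 3 : ℝ) * K ^ 2) := by
  obtain ⟨α, hα, rfl⟩ : ∃ α : ℝ, 0 ≤ α ∧ a = α ^ 3 :=
    ⟨a ^ (1 / 3 : ℝ), by positivity, by rw [← Real.rpow_mul_natCast ha]; norm_num⟩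
  obtain ⟨β, hβ, rfl⟩ : ∃ β : ℝ, 0 ≤ β ∧ b = β ^ 3 :=
    ⟨b ^ (1 / 3 : ℝ), by positivity, by rw [← Real.rpow_mul_natCast hb]; norm_num⟩
  have h4 : ∀ x : ℝ, 0 ≤ x → (x ^ 3) ^ (4 / 3 : ℝ) = x ^ 4 := by
    intro x hx
    rw [← Real.rpow_natCast_mul hx, ← Real.rpow_natCast x 4]; norm_num
  rw [h4 α hα, h4 β hβ]
  have h1 : 0 ≤ (4 * l)⁻¹ * (2 * (l * (α ^ 2 * β ^ 2) - K * (α * β)) ^ 2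
      + K ^ 2 * (α ^ 2 - β ^ 2) ^ 2) := by positivity
  have h2 : l * (4 * l)⁻¹ = 1 / 4 := by field_simp
  linear_combination h1 + (2 * l * (α ^ 4 * β ^ 4) - 4 * K * α ^ 3 * β ^ 3) * h2

/-- A trilinear estimate of Young's type: the quadratic form with multiplier `c` is controlled by
the `L^{4/3}` norm as soon as `c` is square summable. -/
theorem sum_mul_fcoeff_sq_le {g : V → ℂ} (hg : Continuous g) (S : Finset (Fin 3 → ℤ))
    (c : (Fin 3 → ℤ) → ℝ) {κ : ℝ} (hκ : 0 < κ) (hc : ∑ k ∈ S, c k ^ 2 ≤ κ) :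
    ∑ k ∈ S, c k * ‖fcoeff g k‖ ^ 2 ≤
      √κ * (∫ x, ‖g x‖ ^ (4 / 3 : ℝ) ∂cubeMeasure) ^ (3 / 2 : ℝ) := by
  set A := ∫ x, ‖g x‖ ^ (4 / 3 : ℝ) ∂cubeMeasure with hA
  set L := ∑ k ∈ S, c k * ‖fcoeff g k‖ ^ 2 with hL
  have hA0 : 0 ≤ A := integral_nonneg fun x => by positivity
  -- The convolution kernel with multiplier `c`. By Parseval each of its slices has squared L² norm
  -- ∑ c², and the quadratic form is its double integral against `g` and the conjugate of `g`.
  let K : V × V → ℂ := fun z => ∑ k ∈ S, (c k : ℂ) * (conj (chi k z.1) * chi k z.2)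
  have hKc : Continuous K := continuous_finsetSum _ fun k _ => continuous_const.mul
    ((Complex.continuous_conj.comp ((continuous_chi k).comp continuous_fst)).mul
      ((continuous_chi k).comp continuous_snd))
  have hK1 : ∀ x, ∫ y, ‖K (x, y)‖ ^ 2 ∂cubeMeasure ≤ κ := by
    intro x
    have := integral_norm_sum_chi_sq S fun k => (c k : ℂ) * conj (chi k x)
    simp only [K, ← mul_assoc]
    rw [this]
    simpa [norm_chi] using hc
  have hK2 : ∀ y, ∫ x, ‖K (x, y)‖ ^ 2 ∂cubeMeasure ≤ κ := by
    intro y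
    have := integral_norm_sum_chi_sq S fun k => (c k : ℂ) * conj (chi k y)
    have h2 : ∀ x, ‖K (x, y)‖ = ‖∑ k ∈ S, (c k : ℂ) * conj (chi k y) * chi k x‖ := by
      intro x
      rw [← Complex.norm_conj (∑ k ∈ S, _)]
      simp only [map_sum, map_mul, Complex.conj_conj, Complex.conj_ofReal]
      congr 1
      exact Finset.sum_congr rfl fun k _ => by ring
    simp only [h2]
    rw [this]
    simpa [norm_chi] using hc
  have hgr : Continuous fun x => ‖g x‖ ^ (4 / 3 : ℝ) :=
    hg.norm.rpow_const fun _ => Or.inr (by norm_num)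
  have hLK : (L : ℂ) = ∫ z, K z * g z.1 * conj (g z.2) ∂cubeMeasure.prod cubeMeasure := by
    have h1 : ∀ z, K z * g z.1 * conj (g z.2) =
        ∑ k ∈ S, (c k : ℂ) * ((conj (chi k z.1) * g z.1) * (chi k z.2 * conj (g z.2))) := by
      intro z
      simp only [K, Finset.sum_mul]
      exact Finset.sum_congr rfl fun k _ => by ring
    simp only [h1]
    rw [integral_finsetSum]
    · rw [hL]; push_cast
      refine Finset.sum_congr rfl fun k _ => ?_
      rw [integral_const_mul, integral_prod_mul (fun x => conj (chi k x) * g x)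
        (fun y => chi k y * conj (g y))]
      have h3 : ∫ y, chi k y * conj (g y) ∂cubeMeasure = conj (fcoeff g k) := by
        rw [fcoeff, ← integral_conj]
        simp
      rw [h3, ← fcoeff, Complex.mul_conj']
    · intro k _
      refine (integrable_cube_prod ?_).const_mul _
      have := continuous_chi k
      fun_prop
  have hmain : ∀ l : ℝ, 0 < l → L ≤ l / 2 * A ^ 2 + (2 * l)⁻¹ * (A * κ) := by
    intro l hl
    have hi1 : Integrable (fun z : V × V => ‖g z.1‖ ^ (4 / 3 : ℝ) * ‖g z.2‖ ^ (4 / 3 : ℝ))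
        (cubeMeasure.prod cubeMeasure) :=
      integrable_cube_prod ((hgr.comp continuous_fst).mul (hgr.comp continuous_snd))
    have hi2 : Integrable (fun z : V × V => ‖g z.1‖ ^ (4 / 3 : ℝ) * ‖K z‖ ^ 2)
        (cubeMeasure.prod cubeMeasure) :=
      integrable_cube_prod ((hgr.comp continuous_fst).mul (hKc.norm.pow 2))
    have hi3 : Integrable (fun z : V × V => ‖g z.2‖ ^ (4 / 3 : ℝ) * ‖K z‖ ^ 2)
        (cubeMeasure.prod cubeMeasure) :=
      integrable_cube_prod ((hgr.comp continuous_snd).mul (hKc.norm.pow 2))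
    have e1 : ∫ z : V × V, ‖g z.1‖ ^ (4 / 3 : ℝ) * ‖g z.2‖ ^ (4 / 3 : ℝ)
        ∂cubeMeasure.prod cubeMeasure = A ^ 2 := by
      rw [integral_prod_mul (fun x => ‖g x‖ ^ (4 / 3 : ℝ)) (fun x => ‖g x‖ ^ (4 / 3 : ℝ)), sq]
    have e2 : ∫ z : V × V, ‖g z.1‖ ^ (4 / 3 : ℝ) * ‖K z‖ ^ 2 ∂cubeMeasure.prod cubeMeasure
        ≤ A * κ := by
      rw [integral_prod _ hi2, hA, ← integral_mul_const]
      refine integral_mono hi2.integral_prod_left ((integrable_cube hgr).mul_const _) fun x => ?_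
      simp only [integral_const_mul]
      exact mul_le_mul_of_nonneg_left (hK1 x) (by positivity)
    have e3 : ∫ z : V × V, ‖g z.2‖ ^ (4 / 3 : ℝ) * ‖K z‖ ^ 2 ∂cubeMeasure.prod cubeMeasure
        ≤ A * κ := by
      rw [integral_prod_symm _ hi3, hA, ← integral_mul_const]
      refine integral_mono hi3.integral_prod_right ((integrable_cube hgr).mul_const _) fun x => ?_
      simp only [integral_const_mul]
      exact mul_le_mul_of_nonneg_left (hK2 x) (by positivity)
    have e4 : L ≤ ∫ z : V × V, ‖K z‖ * ‖g z.1‖ * ‖g z.2‖ ∂cubeMeasure.prod cubeMeasure := by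
      calc L ≤ ‖(L : ℂ)‖ := by rw [Complex.norm_real]; exact le_abs_self L
        _ ≤ _ := by
          rw [hLK]
          refine (norm_integral_le_integral_norm _).trans_eq ?_
          simp
    have hi4 : Integrable (fun z : V × V => ‖g z.1‖ ^ (4 / 3 : ℝ) * ‖K z‖ ^ 2
        + ‖g z.2‖ ^ (4 / 3 : ℝ) * ‖K z‖ ^ 2) (cubeMeasure.prod cubeMeasure) := hi2.add hi3
    have hi5 : Integrable (fun z : V × V =>
        l / 2 * (‖g z.1‖ ^ (4 / 3 : ℝ) * ‖g z.2‖ ^ (4 / 3 : ℝ)) + (4 * l)⁻¹ *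
          (‖g z.1‖ ^ (4 / 3 : ℝ) * ‖K z‖ ^ 2 + ‖g z.2‖ ^ (4 / 3 : ℝ) * ‖K z‖ ^ 2))
        (cubeMeasure.prod cubeMeasure) := (hi1.const_mul (l / 2)).add (hi4.const_mul _)
    refine e4.trans ((integral_mono (integrable_cube_prod ?_) hi5
      fun z => kernel_mul_le (norm_nonneg _) (norm_nonneg _) hl).trans ?_)
    · fun_prop
    · rw [integral_add (hi1.const_mul _) (hi4.const_mul _),
        integral_const_mul, integral_const_mul, e1, integral_add hi2 hi3]
      have : (2 * l)⁻¹ * (A * κ) = (4 * l)⁻¹ * (A * κ + A * κ) := by field_simp; ring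
      rw [this]
      gcongr
  rcases hA0.eq_or_lt with h0 | hpos
  · have := hmain 1 one_pos
    rw [← h0] at this ⊢
    rw [Real.zero_rpow (by norm_num)]
    simpa using this
  -- This weight equalizes the two terms of `hmain`; each becomes half of √κ A^(3/2).
  · refine (hmain (√κ * A ^ (-(1 / 2) : ℝ)) (by positivity)).trans_eq ?_
    set r := A ^ (1 / 2 : ℝ) with hr
    have hrpos : 0 < r := by positivity
    have hA2 : A = r ^ 2 := by rw [hr, ← Real.rpow_mul_natCast hA0]; norm_num
    have h32 : A ^ (3 / 2 : ℝ) = r ^ 3 := by rw [hr, ← Real.rpow_mul_natCast hA0]; norm_num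
    have hs : 0 < √κ := by positivity
    rw [h32, Real.rpow_neg hA0, ← hr]
    have hk2 := Real.sq_sqrt hκ.le
    rw [hA2]
    field_simp
    linear_combination -hk2

/-- The square of the Euclidean length of an integer vector. -/
def sqLen (k : Fin 3 → ℤ) : ℝ := ∑ i, (k i : ℝ) ^ 2

theorem sqLen_nonneg (k : Fin 3 → ℤ) : 0 ≤ sqLen k := Finset.sum_nonneg fun _ _ => sq_nonneg _

theorem sqLen_pos {k : Fin 3 → ℤ} (hk : k ≠ 0) : 0 < sqLen k := by
  obtain ⟨j, hj⟩ := Function.ne_iff.1 hk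
  refine Finset.sum_pos' (fun _ _ => sq_nonneg _) ⟨j, Finset.mem_univ _, ?_⟩
  have : (k j : ℝ) ≠ 0 := by exact_mod_cast hj
  positivity

/-- The sum of |k|^(-4) over ℤ³ converges because 4 exceeds the dimension; the sup norm of the
lattice point is at most the Euclidean length. The convention 0⁻¹ = 0 discards the zero frequency.
-/
theorem exists_sum_inv_sqLen_sq_le :
    ∃ κ : ℝ, 0 < κ ∧ ∀ S : Finset (Fin 3 → ℤ), ∑ k ∈ S, ((sqLen k)⁻¹) ^ 2 ≤ κ := by
  let b := Pi.basisFun ℝ (Fin 3)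
  have hs := ZLattice.summable_norm_pow_inv (L := Submodule.span ℤ (Set.range b)) 4 (by
    rw [ZLattice.rank ℝ]; simp)
  let φ : (Fin 3 → ℤ) → Submodule.span ℤ (Set.range b) := fun k =>
    ⟨fun i => (k i : ℝ), by
      have : (fun i => (k i : ℝ)) = ∑ i, k i • b i := by
        ext j; simp [b, Finset.sum_apply, Pi.single_apply]
      rw [this]
      exact Submodule.sum_mem _ fun i _ => Submodule.smul_mem _ _ (Submodule.subset_span ⟨i, rfl⟩)⟩
  have hφ : Function.Injective φ := by
    intro k l h
    ext i
    have := congrFun (congrArg Subtype.val h) i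
    simpa [φ] using this
  have hs2 := hs.comp_injective hφ
  have hle : ∀ k, ((sqLen k)⁻¹) ^ 2 ≤ ‖φ k‖⁻¹ ^ 4 := by
    intro k
    rcases eq_or_ne k 0 with rfl | hk
    · have : sqLen 0 = 0 := by simp [sqLen]
      rw [this]; simp
    have h1 : ‖φ k‖ ≤ √(sqLen k) := by
      rw [Submodule.coe_norm, pi_norm_le_iff_of_nonneg (Real.sqrt_nonneg _)]
      intro i
      rw [Real.norm_eq_abs, ← Real.sqrt_sq_eq_abs]
      refine Real.sqrt_le_sqrt ?_
      exact Finset.single_le_sum (f := fun i => (k i : ℝ) ^ 2) (fun _ _ => sq_nonneg _)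
        (Finset.mem_univ i)
    have h2 : 0 < ‖φ k‖ := by
      rw [norm_pos_iff]
      intro h
      exact hk (hφ (h.trans (by ext; simp [φ])))
    rw [inv_pow, inv_pow]
    refine inv_anti₀ (by positivity) ?_
    calc ‖φ k‖ ^ 4 ≤ √(sqLen k) ^ 4 := by gcongr
      _ = (√(sqLen k) ^ 2) ^ 2 := by ring
      _ = sqLen k ^ 2 := by rw [Real.sq_sqrt (sqLen_nonneg k)]
  refine ⟨∑' k, (‖φ k‖⁻¹ ^ 4) + 1, ?_, fun S => ?_⟩
  · have : 0 ≤ ∑' k, (‖φ k‖⁻¹ ^ 4) := tsum_nonneg fun k =>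
      pow_nonneg (inv_nonneg.2 (norm_nonneg _)) 4
    linarith
  · have := hs2.sum_le_tsum S fun k _ => pow_nonneg (inv_nonneg.2 (norm_nonneg _)) 4
    have h3 := Finset.sum_le_sum fun k (_ : k ∈ S) => hle k
    linarith

/-- The embedding of `L^{4/3}` into the homogeneous Sobolev space of order `-1`. -/
theorem exists_sum_inv_sqLen_mul_le : ∃ C : ℝ, 0 < C ∧ ∀ g : V → ℂ, Continuous g → ∀ S,
    ∑ k ∈ S, (sqLen k)⁻¹ * ‖fcoeff g k‖ ^ 2 ≤
      C * (∫ x, ‖g x‖ ^ (4 / 3 : ℝ) ∂cubeMeasure) ^ (3 / 2 : ℝ) := by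
  obtain ⟨κ, hκ, h⟩ := exists_sum_inv_sqLen_sq_le
  exact ⟨√κ, by positivity, fun g hg S => sum_mul_fcoeff_sq_le hg S _ hκ (h S)⟩

/-! ### Korn, Poincaré and Sobolev inequalities for smooth solenoidal fields -/

/-- The `i`-th component of a real vector field, as a complex valued function. -/
def comp (Φ : V → V) (i : Fin 3) (x : V) : ℂ := (Φ x i : ℂ)

theorem contDiff_comp {Φ : V → V} (h : ContDiff ℝ ∞ Φ) (i : Fin 3) : ContDiff ℝ ∞ (comp Φ i) :=
  (Complex.ofRealCLM.comp (EuclideanSpace.proj i : V →L[ℝ] ℝ)).contDiff.comp h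

theorem fderiv_comp_eq_grad {Φ : V → V} (h : ContDiff ℝ ∞ Φ) (i j : Fin 3) (x : V) :
    fderiv ℝ (comp Φ i) x (e j) = (grad Φ x (i, j) : ℂ) := by
  have h1 := (Complex.ofRealCLM.comp (EuclideanSpace.proj i : V →L[ℝ] ℝ)).hasFDerivAt.comp x
    (h.differentiable (by simp) x).hasFDerivAt
  have h2 : HasFDerivAt (comp Φ i) _ x := h1
  rw [h2.fderiv]
  simp [grad]

theorem continuous_grad {Φ : V → V} (h : ContDiff ℝ ∞ Φ) : Continuous (grad Φ) := by
  refine (PiLp.continuous_toLp 2 _).comp (continuous_pi fun ij => ?_)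
  exact (EuclideanSpace.proj ij.1 : V →L[ℝ] ℝ).continuous.comp
    ((h.continuous_fderiv (by simp)).clm_apply continuous_const)

/-- The symmetric part as a linear map. -/
def symPartL : M →L[ℝ] M := LinearMap.toContinuousLinearMap
  { toFun := symPart
    map_add' := fun A B => by ext ij; simp [symPart]; ring
    map_smul' := fun c A => by ext ij; simp [symPart]; ring }

theorem symPartL_apply (A : M) : symPartL A = symPart A := rfl

theorem continuous_symPart : Continuous symPart := symPartL.continuous

theorem norm_symPart_le (A : M) : ‖symPart A‖ ≤ ‖A‖ := by
  have h1 : ‖(WithLp.toLp 2 fun ij => A (ij.2, ij.1) : M)‖ = ‖A‖ := by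
    rw [EuclideanSpace.norm_eq, EuclideanSpace.norm_eq]
    congr 1
    exact Fintype.sum_equiv (Equiv.prodComm _ _) _ _ fun ij => rfl
  have h2 : symPart A = (1 / 2 : ℝ) • (A + WithLp.toLp 2 fun ij => A (ij.2, ij.1)) := by
    ext ij; simp [symPart]; ring
  rw [h2, norm_smul]
  have := norm_add_le A (WithLp.toLp 2 fun ij => A (ij.2, ij.1) : M)
  rw [h1] at this
  rw [Real.norm_of_nonneg (by norm_num)]
  linarith

theorem fcoeff_comp_zero {Φ : V → V} (hΦ : IsSmoothSolenoidal Φ) (i : Fin 3) :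
    fcoeff (comp Φ i) 0 = 0 := by
  have h := (Complex.ofRealCLM.comp (EuclideanSpace.proj i : V →L[ℝ] ℝ)).integral_comp_comm
    (integrable_cube hΦ.smooth.continuous)
  rw [hΦ.mean_zero, map_zero] at h
  simpa [fcoeff, chi, phase_apply, comp] using h

theorem isSpacePeriodic_comp {Φ : V → V} (h : IsSpacePeriodic Φ) (i : Fin 3) :
    IsSpacePeriodic (comp Φ i) := fun j x => by rw [comp, comp, h]

/-- The Fourier coefficients of the gradient. -/
theorem fcoeff_grad {Φ : V → V} (h : ContDiff ℝ ∞ Φ) (hp : IsSpacePeriodic Φ) (i j : Fin 3)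
    (k : Fin 3 → ℤ) : fcoeff (fun x => (grad Φ x (i, j) : ℂ)) k =
      2 * Real.pi * Complex.I * (k j : ℂ) * fcoeff (comp Φ i) k := by
  rw [← fcoeff_fderiv ((contDiff_comp h i).of_le (by simp)) (isSpacePeriodic_comp hp i)]
  simp only [fderiv_comp_eq_grad h]

theorem continuous_entry {Φ : V → V} (h : ContDiff ℝ ∞ Φ) (i j : Fin 3) :
    Continuous fun x => (grad Φ x (i, j) : ℂ) :=
  Complex.continuous_ofReal.comp
    ((EuclideanSpace.proj (i, j) : M →L[ℝ] ℝ).continuous.comp (continuous_grad h))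

theorem fcoeff_add {g h : V → ℂ} (hg : Continuous g) (hh : Continuous h) (k : Fin 3 → ℤ) :
    fcoeff (fun x => g x + h x) k = fcoeff g k + fcoeff h k := by
  simp only [fcoeff, mul_add]
  exact integral_add (integrable_cube ((Complex.continuous_conj.comp (continuous_chi k)).mul hg))
    (integrable_cube ((Complex.continuous_conj.comp (continuous_chi k)).mul hh))

theorem fcoeff_const_mul (c : ℂ) (g : V → ℂ) (k : Fin 3 → ℤ) :
    fcoeff (fun x => c * g x) k = c * fcoeff g k := by
  simp only [fcoeff, mul_left_comm _ c, integral_const_mul]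

/-- The Fourier coefficients of the symmetric gradient. -/
theorem fcoeff_symPart {Φ : V → V} (h : ContDiff ℝ ∞ Φ) (hp : IsSpacePeriodic Φ) (i j : Fin 3)
    (k : Fin 3 → ℤ) : fcoeff (fun x => (symPart (grad Φ x) (i, j) : ℂ)) k =
      Real.pi * Complex.I * ((k j : ℂ) * fcoeff (comp Φ i) k + (k i : ℂ) * fcoeff (comp Φ j) k) := by
  have h1 : (fun x => (symPart (grad Φ x) (i, j) : ℂ)) =
      fun x => (1 / 2 : ℂ) * ((grad Φ x (i, j) : ℂ) + (grad Φ x (j, i) : ℂ)) := by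
    ext x; simp [symPart]; ring
  rw [h1, fcoeff_const_mul, fcoeff_add (continuous_entry h i j) (continuous_entry h j i),
    fcoeff_grad h hp, fcoeff_grad h hp]
  ring

/-- A solenoidal field is determined by the divergence of its symmetric gradient. -/
theorem sum_mul_fcoeff_symPart {Φ : V → V} (hΦ : IsSmoothSolenoidal Φ) (i : Fin 3)
    (k : Fin 3 → ℤ) :
    ∑ j, (k j : ℂ) * fcoeff (fun x => (symPart (grad Φ x) (i, j) : ℂ)) k =
      Real.pi * Complex.I * (sqLen k : ℂ) * fcoeff (comp Φ i) k := by
  have hdiv : ∑ j, (k j : ℂ) * fcoeff (comp Φ j) k = 0 := by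
    have h1 : fcoeff (fun x => ∑ j, (grad Φ x (j, j) : ℂ)) k = 0 := by
      have : ∀ x, ∑ j, (grad Φ x (j, j) : ℂ) = 0 := fun x => by exact_mod_cast hΦ.div_zero x
      simp [this, fcoeff]
    simp only [Fin.sum_univ_three] at h1 ⊢
    have h01 : Continuous fun x => (grad Φ x (0, 0) : ℂ) + (grad Φ x (1, 1) : ℂ) :=
      (continuous_entry hΦ.smooth 0 0).add (continuous_entry hΦ.smooth 1 1)
    rw [fcoeff_add h01 (continuous_entry hΦ.smooth 2 2), fcoeff_add (continuous_entry hΦ.smooth 0 0)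
      (continuous_entry hΦ.smooth 1 1)] at h1
    simp only [fcoeff_grad hΦ.smooth hΦ.periodic] at h1
    have h2 : (2 * Real.pi * Complex.I : ℂ) ≠ 0 := by simp [Real.pi_ne_zero]
    refine (mul_eq_zero.1 ?_).resolve_left h2
    rw [← h1]; ring
  have hk : (sqLen k : ℂ) = ∑ j, (k j : ℂ) ^ 2 := by simp [sqLen]
  simp only [fcoeff_symPart hΦ.smooth hΦ.periodic, hk, Finset.sum_mul, Finset.mul_sum]
  rw [← sub_eq_zero, ← Finset.sum_sub_distrib]
  -- The Fourier form of ∑ⱼ ∂ⱼDᵢⱼ = ½(ΔΦᵢ + ∂ᵢ div Φ): the discrepancy is the divergence term.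
  calc _ = Real.pi * Complex.I * k i * ∑ j, (k j : ℂ) * fcoeff (comp Φ j) k := by
        rw [Finset.mul_sum]; exact Finset.sum_congr rfl fun j _ => by ring
    _ = 0 := by rw [hdiv, mul_zero]

/-- Korn's inequality frequency by frequency: Cauchy-Schwarz in `sum_mul_fcoeff_symPart` gains one
factor |k|, and π is bounded below by 1. At frequency zero the mean value condition is needed. -/
theorem norm_fcoeff_comp_sq_le {Φ : V → V} (hΦ : IsSmoothSolenoidal Φ) (i : Fin 3)
    (k : Fin 3 → ℤ) :
    ‖fcoeff (comp Φ i) k‖ ^ 2 ≤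
      ∑ j, (sqLen k)⁻¹ * ‖fcoeff (fun x => (symPart (grad Φ x) (i, j) : ℂ)) k‖ ^ 2 := by
  rcases eq_or_ne k 0 with rfl | hk
  · rw [fcoeff_comp_zero hΦ]
    rw [norm_zero, zero_pow two_ne_zero]
    exact Finset.sum_nonneg fun j _ => mul_nonneg (inv_nonneg.2 (sqLen_nonneg _)) (sq_nonneg _)
  have hpos := sqLen_pos hk
  have h := congrArg norm (sum_mul_fcoeff_symPart hΦ i k)
  simp only [norm_mul, Complex.norm_I, Complex.norm_real, Real.norm_of_nonneg Real.pi_pos.le,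
    Real.norm_of_nonneg hpos.le, mul_one] at h
  set a := ‖fcoeff (comp Φ i) k‖ with ha
  set D := fun j => ‖fcoeff (fun x => (symPart (grad Φ x) (i, j) : ℂ)) k‖ with hD
  have h1 : Real.pi * sqLen k * a ≤ ∑ j, |(k j : ℝ)| * D j := by
    rw [← h]
    refine (norm_sum_le _ _).trans_eq (Finset.sum_congr rfl fun j _ => ?_)
    rw [norm_mul, Complex.norm_intCast]
  have h2 : (∑ j, |(k j : ℝ)| * D j) ^ 2 ≤ sqLen k * ∑ j, D j ^ 2 := by
    have := Finset.sum_mul_sq_le_sq_mul_sq Finset.univ (fun j => |(k j : ℝ)|) D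
    simpa [sqLen] using this
  have h3 : sqLen k * a ≤ ∑ j, |(k j : ℝ)| * D j := by
    refine le_trans ?_ h1
    have := Real.pi_gt_three
    have : 0 ≤ sqLen k * a := by positivity
    nlinarith
  have h4 : (sqLen k * a) ^ 2 ≤ sqLen k * ∑ j, D j ^ 2 := (by gcongr : _ ≤ _).trans h2
  rw [← Finset.mul_sum, ← div_eq_inv_mul, le_div_iff₀ hpos]
  have h5 : sqLen k * (a ^ 2 * sqLen k) ≤ sqLen k * ∑ j, D j ^ 2 := by linarith
  exact le_of_mul_le_mul_left h5 hpos

theorem norm_apply_le_norm {ι : Type*} [Fintype ι] (A : EuclideanSpace ℝ ι) (i : ι) :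
    ‖A i‖ ≤ ‖A‖ := PiLp.norm_apply_le A i

/-- The `L²` norm of a smooth solenoidal field is controlled by the `L^{4/3}` norm of its symmetric
gradient. -/
theorem exists_integral_norm_sq_le : ∃ C : ℝ, 0 < C ∧ ∀ Φ : V → V, IsSmoothSolenoidal Φ →
    ∫ x, ‖Φ x‖ ^ 2 ∂cubeMeasure ≤
      C * (∫ x, ‖symPart (grad Φ x)‖ ^ (4 / 3 : ℝ) ∂cubeMeasure) ^ (3 / 2 : ℝ) := by
  obtain ⟨C, hC, hCS⟩ := exists_sum_inv_sqLen_mul_le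
  refine ⟨9 * C, by positivity, fun Φ hΦ => ?_⟩
  have hcs : Continuous fun x => symPart (grad Φ x) :=
    continuous_symPart.comp (continuous_grad hΦ.smooth)
  set B := (∫ x, ‖symPart (grad Φ x)‖ ^ (4 / 3 : ℝ) ∂cubeMeasure) ^ (3 / 2 : ℝ) with hB
  have hce : ∀ i j, Continuous fun x => (symPart (grad Φ x) (i, j) : ℂ) := fun i j =>
    Complex.continuous_ofReal.comp ((EuclideanSpace.proj (i, j) : M →L[ℝ] ℝ).continuous.comp hcs)
  have h1 : ∀ i j (S : Finset (Fin 3 → ℤ)), ∑ k ∈ S,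
      (sqLen k)⁻¹ * ‖fcoeff (fun x => (symPart (grad Φ x) (i, j) : ℂ)) k‖ ^ 2 ≤ C * B := by
    intro i j S
    refine (hCS _ (hce i j) S).trans ?_
    rw [hB]
    gcongr ?_ * ?_ ^ _
    refine integral_mono (integrable_cube ((hce i j).norm.rpow_const fun _ => Or.inr (by norm_num)))
      (integrable_cube (hcs.norm.rpow_const fun _ => Or.inr (by norm_num))) fun x => ?_
    dsimp only
    gcongr
    rw [Complex.norm_real]
    exact norm_apply_le_norm _ _
  have h2 : ∀ i, ∫ x, ‖comp Φ i x‖ ^ 2 ∂cubeMeasure ≤ 3 * (C * B) := by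
    intro i
    refine hasSum_le_of_sum_le (hasSum_norm_fcoeff_sq
      (memLp_cube (contDiff_comp hΦ.smooth i).continuous 2)) fun S => ?_
    refine (Finset.sum_le_sum fun k _ => norm_fcoeff_comp_sq_le hΦ i k).trans ?_
    rw [Finset.sum_comm]
    refine (Finset.sum_le_sum fun j _ => h1 i j S).trans ?_
    simp
  have h3 : ∀ x, ‖Φ x‖ ^ 2 = ∑ i, ‖comp Φ i x‖ ^ 2 := by
    intro x
    rw [EuclideanSpace.norm_sq_eq]
    simp [comp]
  simp only [h3]
  rw [integral_finsetSum]
  · refine (Finset.sum_le_sum fun i _ => h2 i).trans_eq ?_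
    simp; ring
  · intro i _
    exact integrable_cube ((contDiff_comp hΦ.smooth i).continuous.norm.pow 2)

/-- The `L⁴` norm of a component of a smooth periodic field with mean value zero is controlled by
the `L²` norm of the gradient. -/
theorem exists_integral_comp_pow_four_le : ∃ C : ℝ, 0 < C ∧ ∀ Φ : V → V, IsSmoothSolenoidal Φ →
    ∀ i, ∫ x, ‖comp Φ i x‖ ^ 4 ∂cubeMeasure ≤ C * (∫ x, ‖grad Φ x‖ ^ 2 ∂cubeMeasure) ^ 2 := by
  obtain ⟨C, hC, hCS⟩ := exists_sum_inv_sqLen_mul_le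
  refine ⟨C ^ 2, by positivity, fun Φ hΦ i => ?_⟩
  have hu : Continuous (comp Φ i) := (contDiff_comp hΦ.smooth i).continuous
  set u := comp Φ i with hudef
  -- Duality: ∫ u⁴ pairs u with u³, and the L^(4/3) norm of u³ is again a power of ∫ u⁴. Pairing H¹
  -- with H^(-1) gives A ≤ √(B C A^(3/2)), where the power of A on the right is 3/4 and can be
  -- absorbed.
  let g : V → ℂ := fun x => u x ^ 3
  have hg : Continuous g := hu.pow 3
  set A := ∫ x, ‖u x‖ ^ 4 ∂cubeMeasure with hA
  set B := ∫ x, ‖grad Φ x‖ ^ 2 ∂cubeMeasure with hB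
  have hA0 : 0 ≤ A := integral_nonneg fun x => by positivity
  have hB0 : 0 ≤ B := integral_nonneg fun x => by positivity
  have hgA : ∫ x, ‖g x‖ ^ (4 / 3 : ℝ) ∂cubeMeasure = A := by
    rw [hA]
    congr 1; ext x
    simp only [g, norm_pow]
    rw [← Real.rpow_natCast_mul (norm_nonneg _), ← Real.rpow_natCast]
    norm_num
  have hconj : ∀ x, conj (u x) = u x := fun x => Complex.conj_ofReal _
  have hP := hasSum_fcoeff (memLp_cube hu 2) (memLp_cube hg 2)
  have hPA : ∫ x, conj (u x) * g x ∂cubeMeasure = (A : ℂ) := by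
    rw [hA, ← integral_complex_ofReal]
    congr 1; ext x
    have : (‖u x‖ : ℂ) ^ 2 = u x * u x := by
      rw [← Complex.mul_conj', hconj]
    push_cast
    rw [hconj, show (‖u x‖ : ℂ) ^ 4 = (‖u x‖ ^ 2) ^ 2 by ring, this]
    ring
  rw [hPA] at hP
  have hgrad : ∀ S : Finset (Fin 3 → ℤ), ∑ k ∈ S, sqLen k * ‖fcoeff u k‖ ^ 2 ≤ B := by
    intro S
    have h1 : ∀ k, sqLen k * ‖fcoeff u k‖ ^ 2 ≤
        ∑ j, ‖fcoeff (fun x => (grad Φ x (i, j) : ℂ)) k‖ ^ 2 := by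
      intro k
      rw [sqLen, Finset.sum_mul]
      refine Finset.sum_le_sum fun j _ => ?_
      rw [fcoeff_grad hΦ.smooth hΦ.periodic, norm_mul, mul_pow]
      refine mul_le_mul_of_nonneg_right ?_ (by positivity)
      simp only [norm_mul, Complex.norm_I, Complex.norm_real, Complex.norm_intCast,
        Real.norm_of_nonneg Real.pi_pos.le, mul_one, mul_pow, sq_abs]
      have := Real.pi_gt_three
      have h4 : (1 : ℝ) ≤ ‖(2 : ℂ)‖ ^ 2 * Real.pi ^ 2 := by
        rw [Complex.norm_ofNat]; nlinarith
      nlinarith [sq_nonneg (k j : ℝ)]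
    refine (Finset.sum_le_sum fun k _ => h1 k).trans ?_
    rw [Finset.sum_comm]
    have h2 : ∀ j, ∑ k ∈ S, ‖fcoeff (fun x => (grad Φ x (i, j) : ℂ)) k‖ ^ 2 ≤
        ∫ x, ‖(grad Φ x (i, j) : ℂ)‖ ^ 2 ∂cubeMeasure := fun j =>
      sum_le_hasSum S (fun _ _ => by positivity)
        (hasSum_norm_fcoeff_sq (memLp_cube (continuous_entry hΦ.smooth i j) 2))
    refine (Finset.sum_le_sum fun j _ => h2 j).trans ?_
    have hi : ∀ j, Integrable (fun x => ‖(grad Φ x (i, j) : ℂ)‖ ^ 2) cubeMeasure := fun j =>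
      integrable_cube ((continuous_entry hΦ.smooth i j).norm.pow 2)
    rw [← integral_finsetSum _ fun j _ => hi j]
    refine integral_mono (integrable_finsetSum _ fun j _ => hi j)
      (integrable_cube ((continuous_grad hΦ.smooth).norm.pow 2)) fun x => ?_
    dsimp only
    rw [EuclideanSpace.norm_sq_eq, Fintype.sum_prod_type]
    simp only [Complex.norm_real]
    exact Finset.single_le_sum (f := fun i => ∑ j, ‖grad Φ x (i, j)‖ ^ 2)
      (fun _ _ => by positivity) (Finset.mem_univ i)
  have hfin : ∀ S : Finset (Fin 3 → ℤ),
      ‖∑ k ∈ S, conj (fcoeff u k) * fcoeff g k‖ ≤ √(B * (C * A ^ (3 / 2 : ℝ))) := by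
    intro S
    refine (norm_sum_le _ _).trans (Real.le_sqrt_of_sq_le ?_)
    -- Weights |k| and |k|^(-1) prepare Cauchy-Schwarz; the zero frequency, where they do not
    -- cancel, drops out because `u` has mean zero.
    have h1 : ∀ k, ‖conj (fcoeff u k) * fcoeff g k‖ =
        (√(sqLen k) * ‖fcoeff u k‖) * (√((sqLen k)⁻¹) * ‖fcoeff g k‖) := by
      intro k
      rcases eq_or_ne k 0 with rfl | hk
      · rw [hudef, fcoeff_comp_zero hΦ]; simp
      · have := (Real.sqrt_pos.2 (sqLen_pos hk)).ne'
        rw [norm_mul, Complex.norm_conj, Real.sqrt_inv]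
        field_simp
    simp only [h1]
    refine (Finset.sum_mul_sq_le_sq_mul_sq _ _ _).trans ?_
    simp only [mul_pow, Real.sq_sqrt (sqLen_nonneg _),
      Real.sq_sqrt (inv_nonneg.2 (sqLen_nonneg _))]
    have h2 := hCS g hg S
    rw [hgA] at h2
    refine mul_le_mul (hgrad S) h2 ?_ hB0
    exact Finset.sum_nonneg fun k _ => mul_nonneg (inv_nonneg.2 (sqLen_nonneg k)) (sq_nonneg _)
  have hle : A ≤ √(B * (C * A ^ (3 / 2 : ℝ))) := by
    have h1 : ‖(A : ℂ)‖ ≤ _ := le_of_tendsto hP.norm (.of_forall hfin)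
    rwa [Complex.norm_real, Real.norm_of_nonneg hA0] at h1
  rcases hA0.eq_or_lt with h0 | hpos
  · rw [← h0]; positivity
  have h1 : A ^ 2 ≤ B * (C * A ^ (3 / 2 : ℝ)) := by
    have := Real.sq_sqrt (show 0 ≤ B * (C * A ^ (3 / 2 : ℝ)) by positivity)
    rw [← this]; gcongr
  set r := A ^ (1 / 2 : ℝ) with hr
  have hrpos : 0 < r := by positivity
  have hA2 : A = r ^ 2 := by rw [hr, ← Real.rpow_mul_natCast hA0]; norm_num
  have h32 : A ^ (3 / 2 : ℝ) = r ^ 3 := by rw [hr, ← Real.rpow_mul_natCast hA0]; norm_num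
  rw [h32, hA2] at h1
  have h2 : r ≤ C * B := by
    have : r ^ 3 * r ≤ r ^ 3 * (C * B) := by linarith
    exact le_of_mul_le_mul_left this (by positivity)
  rw [hA2, ← mul_pow]
  gcongr

theorem eLpNorm_two_eq {E : Type*} [NormedAddCommGroup E] [SecondCountableTopology E] {g : V → E}
    (hg : Continuous g) :
    eLpNorm g 2 cubeMeasure = ENNReal.ofReal √(∫ x, ‖g x‖ ^ 2 ∂cubeMeasure) := by
  rw [(memLp_cube hg 2).eLpNorm_eq_integral_rpow_norm (by simp) (by simp), Real.sqrt_eq_rpow]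
  simp

/-- Sobolev-Korn inequality for smooth solenoidal fields. -/
theorem exists_eLpNorm_two_le : ∃ C : ℝ, 0 < C ∧ ∀ q : ℝ≥0∞, ENNReal.ofReal (4 / 3) ≤ q →
    ∀ Φ : V → V, IsSmoothSolenoidal Φ → eLpNorm Φ 2 cubeMeasure ≤
      ENNReal.ofReal C * eLpNorm (fun x => symPart (grad Φ x)) q cubeMeasure := by
  obtain ⟨C, hC, h⟩ := exists_integral_norm_sq_le
  refine ⟨√C, by positivity, fun q hq Φ hΦ => ?_⟩
  have hcs : Continuous fun x => symPart (grad Φ x) :=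
    continuous_symPart.comp (continuous_grad hΦ.smooth)
  refine le_trans ?_ (mul_le_mul_right (eLpNorm_le_eLpNorm_of_exponent_le hq
    hcs.aestronglyMeasurable) _)
  rw [eLpNorm_two_eq hΦ.smooth.continuous, (memLp_cube hcs _).eLpNorm_eq_integral_rpow_norm
    (by simp) (by simp), ← ENNReal.ofReal_mul (by positivity)]
  refine ENNReal.ofReal_le_ofReal ?_
  rw [ENNReal.toReal_ofReal (by norm_num)]
  set B := ∫ x, ‖symPart (grad Φ x)‖ ^ (4 / 3 : ℝ) ∂cubeMeasure with hB
  have hB0 : 0 ≤ B := integral_nonneg fun x => by positivity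
  refine (Real.sqrt_le_sqrt (h Φ hΦ)).trans_eq ?_
  rw [Real.sqrt_mul hC.le, Real.sqrt_eq_rpow (B ^ _), ← Real.rpow_mul hB0]
  norm_num

/-- Both inequalities are instances of `exists_eLpNorm_two_le`, with q = 2 and with q = p ≥ 4/3.
Their constants are C and C^p, so the sum serves for both. -/
theorem exists_isSobolevConstant {p : ℝ} (hp : p ∈ Ico (5 / 3 : ℝ) 2) :
    ∃ C : ℝ, IsSobolevConstant p C := by
  obtain ⟨C, hC, h⟩ := exists_eLpNorm_two_le
  have hp0 : 0 < p := by linarith [hp.1]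
  refine ⟨C + C ^ p, by positivity, fun Φ hΦ => ?_, fun Φ hΦ => ?_⟩
  · refine (h 2 (by
      rw [show (2 : ℝ≥0∞) = ENNReal.ofReal 2 by simp]
      exact ENNReal.ofReal_le_ofReal (by norm_num)) Φ hΦ).trans ?_
    gcongr ?_ * ?_
    · exact ENNReal.ofReal_le_ofReal (le_add_of_nonneg_right (by positivity))
    · exact eLpNorm_mono fun x => norm_symPart_le _
  · have h1 := h (ENNReal.ofReal p) (ENNReal.ofReal_le_ofReal (by linarith [hp.1])) Φ hΦ
    refine (ENNReal.rpow_le_rpow h1 hp0.le).trans ?_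
    rw [ENNReal.mul_rpow_of_nonneg _ _ hp0.le, ENNReal.ofReal_rpow_of_pos hC]
    gcongr
    exact le_add_of_nonneg_left hC.le

/-- The embedding of `J^{1,2}` into `L⁴`, on smooth fields. -/
theorem exists_eLpNorm_four_le : ∃ C : ℝ, 0 < C ∧ ∀ Φ : V → V, IsSmoothSolenoidal Φ →
    eLpNorm Φ 4 cubeMeasure ≤ ENNReal.ofReal C * eLpNorm (grad Φ) 2 cubeMeasure := by
  obtain ⟨C, hC, h⟩ := exists_integral_comp_pow_four_le
  refine ⟨(9 * C) ^ (1 / 4 : ℝ), by positivity, fun Φ hΦ => ?_⟩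
  rw [eLpNorm_two_eq (continuous_grad hΦ.smooth), (memLp_cube hΦ.smooth.continuous _
    ).eLpNorm_eq_integral_rpow_norm (by simp) (by simp), ← ENNReal.ofReal_mul (by positivity)]
  refine ENNReal.ofReal_le_ofReal ?_
  set B := ∫ x, ‖grad Φ x‖ ^ 2 ∂cubeMeasure with hB
  have hB0 : 0 ≤ B := integral_nonneg fun x => by positivity
  have hc : ∀ i, Integrable (fun x => ‖comp Φ i x‖ ^ 4) cubeMeasure := fun i =>
    integrable_cube ((contDiff_comp hΦ.smooth i).continuous.norm.pow 4)
  have h1 : ∫ x, ‖Φ x‖ ^ (4 : ℝ≥0∞).toReal ∂cubeMeasure ≤ 9 * C * B ^ 2 := by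
    have h2 : ∀ x, ‖Φ x‖ ^ (4 : ℝ≥0∞).toReal ≤ 3 * ∑ i, ‖comp Φ i x‖ ^ 4 := by
      intro x
      have h3 : ‖Φ x‖ ^ 2 = ∑ i, ‖comp Φ i x‖ ^ 2 := by
        rw [EuclideanSpace.norm_sq_eq]
        simp [comp]
      have h4 : ‖Φ x‖ ^ (4 : ℝ≥0∞).toReal = (‖Φ x‖ ^ 2) ^ 2 := by
        rw [ENNReal.toReal_ofNat, Real.rpow_ofNat]; ring
      rw [h4, h3, Fin.sum_univ_three, Fin.sum_univ_three]
      nlinarith [sq_nonneg (‖comp Φ 0 x‖ ^ 2 - ‖comp Φ 1 x‖ ^ 2),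
        sq_nonneg (‖comp Φ 0 x‖ ^ 2 - ‖comp Φ 2 x‖ ^ 2),
        sq_nonneg (‖comp Φ 1 x‖ ^ 2 - ‖comp Φ 2 x‖ ^ 2)]
    refine (integral_mono (integrable_cube (hΦ.smooth.continuous.norm.rpow_const fun _ =>
      Or.inr (by simp))) ((integrable_finsetSum _ fun i _ => hc i).const_mul 3) h2).trans ?_
    rw [integral_const_mul, integral_finsetSum _ fun i _ => hc i]
    calc _ ≤ 3 * ∑ i : Fin 3, C * B ^ 2 := by
          gcongr with i; exact h Φ hΦ i
      _ = 9 * C * B ^ 2 := by simp; ring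
  refine (Real.rpow_le_rpow (integral_nonneg fun x => by positivity) h1 (by simp)).trans_eq ?_
  rw [Real.mul_rpow (by positivity) (by positivity), Real.sqrt_eq_rpow,
    ← Real.rpow_natCast_mul hB0]
  norm_num

/-! ### Density in J^(1,2) and the embedding into L⁴ -/

theorem IsSmoothSolenoidal.zero : IsSmoothSolenoidal 0 where
  smooth := contDiff_const
  periodic := fun _ _ => rfl
  mean_zero := by simp
  div_zero := fun x => by simp [grad]

theorem grad_sub {Φ Ψ : V → V} (hΦ : ContDiff ℝ ∞ Φ) (hΨ : ContDiff ℝ ∞ Ψ) (x : V) :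
    grad (Φ - Ψ) x = grad Φ x - grad Ψ x := by
  ext ij
  simp only [grad, PiLp.sub_apply]
  rw [fderiv_sub (hΦ.differentiable (by simp) x) (hΨ.differentiable (by simp) x)]
  simp

theorem IsSmoothSolenoidal.sub {Φ Ψ : V → V} (hΦ : IsSmoothSolenoidal Φ)
    (hΨ : IsSmoothSolenoidal Ψ) : IsSmoothSolenoidal (Φ - Ψ) where
  smooth := hΦ.smooth.sub hΨ.smooth
  periodic := fun i x => by simp only [Pi.sub_apply]; rw [hΦ.periodic, hΨ.periodic]
  mean_zero := by
    simp only [Pi.sub_apply]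
    rw [integral_sub (integrable_cube hΦ.smooth.continuous)
      (integrable_cube hΨ.smooth.continuous), hΦ.mean_zero, hΨ.mean_zero, sub_zero]
  div_zero := fun x => by
    simp only [grad_sub hΦ.smooth hΨ.smooth, PiLp.sub_apply, Finset.sum_sub_distrib,
      hΦ.div_zero, hΨ.div_zero, sub_zero]

/-- The smooth elements are dense in `J^{1,2}`. -/
theorem J_induction {P : J 2 → Prop} (hP : IsClosed {u | P u})
    (h : ∀ Φ : V → V, IsSmoothSolenoidal Φ → ∀ u : J 2, u.1.1 =ᵐ[cubeMeasure] Φ →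
      u.1.2 =ᵐ[cubeMeasure] grad Φ → P u) (u : J 2) : P u := by
  obtain ⟨w, hw, hlim⟩ := mem_closure_iff_seq_limit.1 u.2
  have hwJ : ∀ n, w n ∈ J 2 := fun n => subset_closure (hw n)
  have hlim' : Tendsto (fun n => (⟨w n, hwJ n⟩ : J 2)) atTop (𝓝 u) :=
    tendsto_subtype_rng.2 hlim
  refine hP.mem_of_tendsto hlim' (.of_forall fun n => ?_)
  obtain ⟨Φ, hΦ, h1, h2⟩ := hw n
  exact h Φ hΦ _ h1 h2

/-- Fatou's lemma along an almost everywhere convergent subsequence. It carries L^q bounds to an L²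
limit when convergence in L^q is not yet known. -/
theorem eLpNorm_le_of_tendsto {f : ℕ → Lp V 2 cubeMeasure} {g : Lp V 2 cubeMeasure}
    (hf : Tendsto f atTop (𝓝 g)) {q : ℝ≥0∞} {c : ℕ → ℝ} {C : ℝ} (hc : Tendsto c atTop (𝓝 C))
    (hle : ∀ n, eLpNorm (f n) q cubeMeasure ≤ ENNReal.ofReal (c n)) :
    eLpNorm g q cubeMeasure ≤ ENNReal.ofReal C := by
  obtain ⟨ns, hns, hae⟩ := (tendstoInMeasure_of_tendsto_Lp hf).exists_seq_tendsto_ae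
  refine (Lp.eLpNorm_lim_le_liminf_eLpNorm (fun n => Lp.aestronglyMeasurable (f (ns n))) _
    hae).trans ?_
  refine (liminf_le_liminf (.of_forall fun n => hle (ns n))).trans_eq ?_
  exact (ENNReal.tendsto_ofReal (hc.comp hns.tendsto_atTop)).liminf_eq

/-- Differences of smooth solenoidal fields are smooth solenoidal, so the L⁴ bound applies to
differences of approximants. Stating it for differences gives Lipschitz continuity of the embedding
at once. -/
theorem exists_eLpNorm_sub_le : ∃ C : ℝ, 0 < C ∧ ∀ u w : J 2,
    eLpNorm (u.1.1 - w.1.1 : Lp V 2 cubeMeasure) 4 cubeMeasure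
      ≤ ENNReal.ofReal (C * ‖u.1.2 - w.1.2‖) := by
  obtain ⟨C, hC, h⟩ := exists_eLpNorm_four_le
  refine ⟨C, hC, fun u w => ?_⟩
  obtain ⟨f, hf, hlimf⟩ := mem_closure_iff_seq_limit.1 u.2
  obtain ⟨g, hg, hlimg⟩ := mem_closure_iff_seq_limit.1 w.2
  have l1 := (hlimf.fst_nhds).sub (hlimg.fst_nhds)
  have l2 := (((hlimf.snd_nhds).sub (hlimg.snd_nhds)).norm).const_mul C
  refine eLpNorm_le_of_tendsto l1 l2 fun n => ?_
  obtain ⟨Φ, hΦ, h1, h2⟩ := hf n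
  obtain ⟨Ψ, hΨ, h3, h4⟩ := hg n
  have e1 : ((f n).1 - (g n).1 : Lp V 2 cubeMeasure) =ᵐ[cubeMeasure] Φ - Ψ :=
    (Lp.coeFn_sub _ _).trans (h1.sub h3)
  have e2 : ((f n).2 - (g n).2 : Lp M 2 cubeMeasure) =ᵐ[cubeMeasure] grad (Φ - Ψ) := by
    filter_upwards [Lp.coeFn_sub (f n).2 (g n).2, h2, h4] with x a b c
    rw [a, grad_sub hΦ.smooth hΨ.smooth, Pi.sub_apply, b, c]
  rw [eLpNorm_congr_ae e1, ENNReal.ofReal_mul hC.le, ofReal_norm, Lp.enorm_def,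
    eLpNorm_congr_ae e2]
  exact h _ (hΦ.sub hΨ)

theorem zero_mem_J : (0 : W 2) ∈ J 2 :=
  subset_closure ⟨0, .zero, Lp.coeFn_zero _ _ _, by
    filter_upwards [Lp.coeFn_zero M 2 cubeMeasure] with x hx
    rw [Prod.snd_zero, hx]
    ext; simp [grad]⟩

theorem memLp_four (u : J 2) : MemLp u.1.1 4 cubeMeasure := by
  obtain ⟨C, hC, h⟩ := exists_eLpNorm_sub_le
  refine ⟨Lp.aestronglyMeasurable _, lt_of_le_of_lt ?_ (ENNReal.ofReal_lt_top
    (r := C * ‖u.1.2 - (0 : W 2).2‖))⟩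
  have := h u ⟨0, zero_mem_J⟩
  simpa using this

/-- The embedding of `J^{1,2}` into `L⁴`. -/
def toL4 (u : J 2) : Lp V 4 cubeMeasure := (memLp_four u).toLp

theorem coeFn_toL4 (u : J 2) : toL4 u =ᵐ[cubeMeasure] u.1.1 := (memLp_four u).coeFn_toLp

instance : Fact ((1 : ℝ≥0∞) ≤ 4) := ⟨by norm_num⟩

theorem continuous_toL4 : Continuous toL4 := by
  obtain ⟨C, hC, h⟩ := exists_eLpNorm_sub_le
  refine (LipschitzWith.of_dist_le_mul (K := C.toNNReal) fun u w => ?_).continuous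
  have h1 := h u w
  have h2 : toL4 u - toL4 w =ᵐ[cubeMeasure] (u.1.1 - w.1.1 : Lp V 2 cubeMeasure) := by
    filter_upwards [Lp.coeFn_sub (toL4 u) (toL4 w), Lp.coeFn_sub u.1.1 w.1.1,
      coeFn_toL4 u, coeFn_toL4 w] with x a b c d
    rw [a, b, Pi.sub_apply, Pi.sub_apply, c, d]
  rw [dist_eq_norm, Lp.norm_def, eLpNorm_congr_ae h2,
    Real.coe_toNNReal _ hC.le]
  refine (ENNReal.toReal_le_of_le_ofReal (by positivity) h1).trans ?_
  gcongr
  rw [← dist_eq_norm, Subtype.dist_eq]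
  exact le_max_right _ _

/-! ### The convective and stress forms on J^(1,2) -/

/-- The matrix `(wᵢ vⱼ)ᵢⱼ`, bilinear in `v` and `w`. -/
def tensor : V →L[ℝ] V →L[ℝ] M := LinearMap.toContinuousBilinearMap
  (LinearMap.mk₂ ℝ (fun v w => (WithLp.toLp 2 fun ij => v ij.2 * w ij.1 : M))
    (fun _ _ _ => by ext; simp [add_mul]) (fun _ _ _ => by ext; simp [mul_assoc])
    (fun _ _ _ => by ext; simp [mul_add]) (fun _ _ _ => by ext; simp [mul_left_comm]))

theorem inner_tensor (A : M) (v w : V) : inner ℝ A (tensor v w) = inner ℝ (convect v A) w := by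
  simp only [tensor, LinearMap.toContinuousBilinearMap_apply, LinearMap.mk₂_apply, convect,
    PiLp.inner_apply, RCLike.inner_apply, conj_trivial, Fintype.sum_prod_type, Finset.mul_sum]
  exact Finset.sum_congr rfl fun i _ => Finset.sum_congr rfl fun j _ => by ring

/-- Two L⁴ fields have their tensor product in L², which can be paired with a gradient in L²; this
is what makes the convective form continuous on J^(1,2). -/
instance : ENNReal.HolderTriple 4 4 2 := ⟨by
  have h : (4 : ℝ≥0∞) = 2 * 2 := by norm_num
  rw [h, ENNReal.mul_inv (by simp) (by simp), ← two_mul, ← mul_assoc,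
    ENNReal.mul_inv_cancel (by simp) (by simp), one_mul]⟩

/-- The trilinear form of the convective term on `J^{1,2}`. -/
def convectForm (u w : J 2) : ℝ :=
  inner ℝ u.1.2 (tensor.holderL cubeMeasure 4 4 2 (toL4 u) (toL4 w))

theorem convectForm_eq (u w : J 2) : convectForm u w =
    ∫ x, inner ℝ (convect (u.1.1 x) (u.1.2 x)) (w.1.1 x) ∂cubeMeasure := by
  rw [convectForm, L2.inner_def]
  refine integral_congr_ae ?_
  filter_upwards [tensor.coeFn_holder (r := 2) (toL4 u) (toL4 w), coeFn_toL4 u, coeFn_toL4 w]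
    with x h1 h2 h3
  rw [show (tensor.holderL cubeMeasure 4 4 2 (toL4 u) (toL4 w)) = tensor.holder 2 (toL4 u) (toL4 w)
    from rfl, h1, h2, h3, inner_tensor]

theorem continuous_convectForm : Continuous fun z : J 2 × J 2 => convectForm z.1 z.2 := by
  have h := continuous_toL4
  unfold convectForm
  fun_prop

theorem norm_stress_eq {p : ℝ} (hp : 1 < p) (A : M) : ‖stress p A‖ = ‖A‖ ^ (p - 1) := by
  rcases eq_or_ne A 0 with rfl | h
  · simp [stress, Real.zero_rpow (by linarith : p - 1 ≠ 0)]
  · have : 0 < ‖A‖ := norm_pos_iff.2 h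
    rw [stress, norm_smul, Real.norm_of_nonneg (by positivity), ← Real.rpow_add_one this.ne']
    ring_nf

/-- The stress tensor is Hölder continuous with exponent `p - 1`. -/
theorem norm_stress_sub_le {p : ℝ} (hp : 1 < p) (hp2 : p < 2) (A B : M) :
    ‖stress p A - stress p B‖ ≤ 2 * ‖A - B‖ ^ (p - 1) := by
  wlog hAB : ‖B‖ ≤ ‖A‖ generalizing A B
  · rw [norm_sub_rev, norm_sub_rev A]
    exact this B A (le_of_not_ge hAB)
  -- If the distance dominates both norms, the two stresses are estimated separately. Otherwise
  -- |A|^(p-2) ≤ |A-B|^(p-2), and the stress difference is at most 2|A|^(p-2)|A-B|.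
  rcases le_or_gt ‖A‖ ‖A - B‖ with h | h
  · refine (norm_sub_le _ _).trans ?_
    rw [norm_stress_eq hp, norm_stress_eq hp, two_mul]
    gcongr ?_ + ?_
    · exact Real.rpow_le_rpow (norm_nonneg _) h (by linarith)
    · exact Real.rpow_le_rpow (norm_nonneg _) (hAB.trans h) (by linarith)
  · have hA : 0 < ‖A‖ := (norm_nonneg _).trans_lt h
    rcases (norm_nonneg (A - B)).eq_or_lt with h0 | hd
    · have : A = B := sub_eq_zero.1 (norm_eq_zero.1 h0.symm)
      rw [this]; simp; positivity
    have hpow : ‖A‖ ^ (p - 2) ≤ ‖A - B‖ ^ (p - 2) :=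
      Real.rpow_le_rpow_of_nonpos hd h.le (by linarith)
    have hd1 : ‖A - B‖ ^ (p - 1) = ‖A - B‖ ^ (p - 2) * ‖A - B‖ := by
      rw [← Real.rpow_add_one hd.ne']; ring_nf
    have e : stress p A - stress p B
        = ‖A‖ ^ (p - 2) • (A - B) + (‖A‖ ^ (p - 2) - ‖B‖ ^ (p - 2)) • B := by
      simp only [stress]; module
    have h2 : ‖(‖A‖ ^ (p - 2) - ‖B‖ ^ (p - 2)) • B‖ ≤ ‖A‖ ^ (p - 2) * ‖A - B‖ := by
      rcases (norm_nonneg B).eq_or_lt with hB | hB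
      · rw [norm_smul, ← hB, mul_zero]; positivity
      have hle : ‖A‖ ^ (p - 2) ≤ ‖B‖ ^ (p - 2) :=
        Real.rpow_le_rpow_of_nonpos hB hAB (by linarith)
      rw [norm_smul, Real.norm_eq_abs, abs_of_nonpos (by linarith)]
      have h3 : ‖B‖ ^ (p - 2) * ‖B‖ ≤ ‖A‖ ^ (p - 2) * ‖A‖ := by
        rw [← Real.rpow_add_one hA.ne', ← Real.rpow_add_one hB.ne']
        exact Real.rpow_le_rpow hB.le hAB (by linarith)
      have h4 := norm_sub_norm_le A B
      have h5 : 0 ≤ ‖A‖ ^ (p - 2) := by positivity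
      nlinarith
    rw [e]
    refine (norm_add_le _ _).trans ?_
    rw [norm_smul, Real.norm_of_nonneg (by positivity), hd1]
    have : ‖A‖ ^ (p - 2) * ‖A - B‖ ≤ ‖A - B‖ ^ (p - 2) * ‖A - B‖ := by gcongr
    linarith

theorem continuous_stress {p : ℝ} (hp : 1 < p) (hp2 : p < 2) : Continuous (stress p) := by
  refine continuous_iff_continuousAt.2 fun B => tendsto_iff_norm_sub_tendsto_zero.2 ?_
  refine squeeze_zero (fun _ => norm_nonneg _) (fun A => norm_stress_sub_le hp hp2 A B) ?_
  have h : Continuous fun A : M => 2 * ‖A - B‖ ^ (p - 1) :=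
    continuous_const.mul ((continuous_id.sub continuous_const).norm.rpow_const
      fun _ => Or.inr (by linarith))
  have := h.tendsto B
  simpa [Real.zero_rpow (by linarith : p - 1 ≠ 0)] using this

/-- The L² norm of |G-H|^(p-1) is a power of the L^(2(p-1)) norm of G-H, and 2(p-1) ≤ 2 on a
probability space. So the stress is Hölder continuous from L² to L². -/
theorem eLpNorm_stress_sub_le {p : ℝ} (hp : 1 < p) (hp2 : p < 2) {G H : V → M}
    (hG : AEStronglyMeasurable G cubeMeasure) (hH : AEStronglyMeasurable H cubeMeasure) :
    eLpNorm (fun x => stress p (symPart (G x)) - stress p (symPart (H x))) 2 cubeMeasure ≤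
      2 * eLpNorm (fun x => G x - H x) 2 cubeMeasure ^ (p - 1) := by
  have h1 : ∀ x, ‖stress p (symPart (G x)) - stress p (symPart (H x))‖ ≤
      2 * ‖‖G x - H x‖ ^ (p - 1)‖ := fun x => by
    refine (norm_stress_sub_le hp hp2 _ _).trans ?_
    rw [Real.norm_of_nonneg (by positivity)]
    have h2 : ‖symPart (G x) - symPart (H x)‖ ≤ ‖G x - H x‖ := by
      rw [← symPartL_apply, ← symPartL_apply, ← map_sub]
      exact norm_symPart_le _
    gcongr
  refine (eLpNorm_le_mul_eLpNorm_of_ae_le_mul (.of_forall h1) 2).trans ?_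
  rw [eLpNorm_norm_rpow _ (by linarith)]
  refine mul_le_mul' (by simp) (ENNReal.rpow_le_rpow ?_ (by linarith))
  · refine eLpNorm_le_eLpNorm_of_exponent_le ?_ (hG.sub hH)
    calc 2 * ENNReal.ofReal (p - 1) ≤ 2 * 1 := by
          gcongr; exact ENNReal.ofReal_le_one.2 (by linarith)
      _ = 2 := mul_one 2

theorem memLp_stress {p : ℝ} (hp : 1 < p) (hp2 : p < 2) (G : Lp M 2 cubeMeasure) :
    MemLp (fun x => stress p (symPart (G x))) 2 cubeMeasure := by
  refine ⟨((continuous_stress hp hp2).comp continuous_symPart).comp_aestronglyMeasurable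
    (Lp.aestronglyMeasurable G), ?_⟩
  have h := eLpNorm_stress_sub_le hp hp2 (Lp.aestronglyMeasurable G)
    (aestronglyMeasurable_const (b := (0 : M)))
  have h0 : symPart 0 = 0 := symPartL.map_zero
  simp only [h0, sub_zero] at h
  have h1 : stress p 0 = 0 := by simp [stress]
  simp only [h1, sub_zero] at h
  refine h.trans_lt (ENNReal.mul_lt_top (by simp) (ENNReal.rpow_lt_top_of_nonneg (by linarith)
    (Lp.eLpNorm_ne_top G)))

/-- The stress as a map of `L²`. -/
def stressMap (p : ℝ) (hp : 1 < p) (hp2 : p < 2) (G : Lp M 2 cubeMeasure) : Lp M 2 cubeMeasure :=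
  (memLp_stress hp hp2 G).toLp

theorem continuous_stressMap (p : ℝ) (hp : 1 < p) (hp2 : p < 2) :
    Continuous (stressMap p hp hp2) := by
  have h : HolderWith 2 (p - 1).toNNReal (stressMap p hp hp2) := by
    intro G H
    rw [Real.coe_toNNReal _ (by linarith)]
    rw [stressMap, stressMap, Lp.edist_toLp_toLp, Lp.edist_def]
    exact eLpNorm_stress_sub_le hp hp2 (Lp.aestronglyMeasurable G) (Lp.aestronglyMeasurable H)
  exact h.continuous (Real.toNNReal_pos.2 (by linarith))

/-- The stress form on `J^{1,2}`. -/
def stressForm (p : ℝ) (hp : 1 < p) (hp2 : p < 2) (u w : J 2) : ℝ :=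
  inner ℝ (stressMap p hp hp2 u.1.2) (symPartL.compLpL 2 cubeMeasure w.1.2)

theorem stressForm_eq {p : ℝ} (hp : 1 < p) (hp2 : p < 2) (u w : J 2) : stressForm p hp hp2 u w =
    ∫ x, inner ℝ (stress p (symPart (u.1.2 x))) (symPart (w.1.2 x)) ∂cubeMeasure := by
  rw [stressForm, L2.inner_def]
  refine integral_congr_ae ?_
  filter_upwards [(memLp_stress hp hp2 u.1.2).coeFn_toLp,
    symPartL.coeFn_compLpL (p := 2) (μ := cubeMeasure) w.1.2] with x h1 h2
  rw [stressMap, h1, h2, symPartL_apply]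

theorem continuous_stressForm {p : ℝ} (hp : 1 < p) (hp2 : p < 2) :
    Continuous fun z : J 2 × J 2 => stressForm p hp hp2 z.1 z.2 := by
  have h := continuous_stressMap p hp hp2
  unfold stressForm
  fun_prop

/-- For solenoidal Φ, twice the integrand is the divergence of the periodic field |Φ|²Φ. -/
theorem integral_convect_eq_zero {Φ : V → V} (hΦ : IsSmoothSolenoidal Φ) :
    ∫ x, inner ℝ (convect (Φ x) (grad Φ x)) (Φ x) ∂cubeMeasure = 0 := by
  have hc : ∀ i, ContDiff ℝ ∞ fun x => Φ x i := fun i =>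
    (EuclideanSpace.proj i : V →L[ℝ] ℝ).contDiff.comp hΦ.smooth
  let N : V → ℝ := fun x => ∑ i, Φ x i ^ 2
  have hN : ContDiff ℝ ∞ N := ContDiff.sum fun i _ => (hc i).pow 2
  have hp : ∀ i j x, Φ (x + e j) i = Φ x i := fun i j x => by rw [hΦ.periodic]
  have hF : ∀ j, ContDiff ℝ ∞ fun x => Φ x j * N x := fun j => (hc j).mul hN
  have h0 : ∀ j, ∫ x, fderiv ℝ (fun x => Φ x j * N x) x (e j) ∂cubeMeasure = 0 := fun j =>
    integral_fderiv_eq_zero ((hF j).of_le (by simp)) (fun i x => by simp only [N, hp]) j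
  have hdc : ∀ i x, HasFDerivAt (fun x => Φ x i)
      ((EuclideanSpace.proj i : V →L[ℝ] ℝ).comp (fderiv ℝ Φ x)) x := fun i x =>
    (EuclideanSpace.proj i : V →L[ℝ] ℝ).hasFDerivAt.comp x
      (hΦ.smooth.differentiable (by simp) x).hasFDerivAt
  have hder : ∀ x, ∑ j, fderiv ℝ (fun x => Φ x j * N x) x (e j) =
      2 * inner ℝ (convect (Φ x) (grad Φ x)) (Φ x) := by
    intro x
    have hNd : HasFDerivAt N (∑ i, (2 * Φ x i) •
        ((EuclideanSpace.proj i : V →L[ℝ] ℝ).comp (fderiv ℝ Φ x))) x := by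
      have := HasFDerivAt.fun_sum (u := Finset.univ) fun i _ => (hdc i x).pow 2
      simpa using this
    have h1 : ∀ j, fderiv ℝ (fun x => Φ x j * N x) x (e j) =
        Φ x j * ∑ i, 2 * Φ x i * grad Φ x (i, j) + N x * grad Φ x (j, j) := by
      intro j
      have h2 : HasFDerivAt (fun x => Φ x j * N x) _ x := (hdc j x).mul hNd
      rw [h2.fderiv]
      simp [grad]
    simp only [h1]
    rw [Finset.sum_add_distrib, ← Finset.mul_sum, hΦ.div_zero, mul_zero, add_zero]
    simp only [convect, PiLp.inner_apply, RCLike.inner_apply, conj_trivial, Finset.mul_sum]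
    rw [Finset.sum_comm]
    exact Finset.sum_congr rfl fun i _ => Finset.sum_congr rfl fun j _ => by ring
  have hsum : ∫ x, ∑ j, fderiv ℝ (fun x => Φ x j * N x) x (e j) ∂cubeMeasure = 0 := by
    rw [integral_finsetSum]
    · exact Finset.sum_eq_zero fun j _ => h0 j
    · intro j _
      exact integrable_cube (((hF j).continuous_fderiv (by simp)).clm_apply continuous_const)
  simp only [hder, integral_const_mul] at hsum
  linarith

attribute [irreducible] convectForm stressForm

theorem convectForm_self (u : J 2) : convectForm u u = 0 := by
  have hc : Continuous fun u : J 2 => convectForm u u :=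
    continuous_convectForm.comp (f := fun u : J 2 => (u, u)) (by fun_prop)
  refine J_induction (P := fun u => convectForm u u = 0) (isClosed_eq hc continuous_const) ?_ u
  intro Φ hΦ u h1 h2
  rw [convectForm_eq, ← integral_convect_eq_zero hΦ]
  refine integral_congr_ae ?_
  filter_upwards [h1, h2] with x a b
  rw [a, b]

theorem inner_stress_self {p : ℝ} (hp : 1 < p) (A : M) : inner ℝ (stress p A) A = ‖A‖ ^ p := by
  rw [stress, real_inner_smul_left, real_inner_self_eq_norm_sq]
  rcases (norm_nonneg A).eq_or_lt with h | h
  · rw [← h, Real.zero_rpow (by linarith : p ≠ 0)]; simp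
  · rw [← Real.rpow_natCast, ← Real.rpow_add h]; simp

/-- On smooth fields the stress form on the diagonal is ‖DΦ‖_p^p, so this is the Sobolev-Korn
inequality; both sides are continuous on J^(1,2). -/
theorem norm_rpow_le_stressForm {p C : ℝ} (hp : 1 < p) (hp2 : p < 2) (hC : IsSobolevConstant p C)
    (u : J 2) : ‖u.1.1‖ ^ p ≤ C * stressForm p hp hp2 u u := by
  have hc1 : Continuous fun u : J 2 => ‖u.1.1‖ ^ p :=
    (continuous_fst.comp continuous_subtype_val).norm.rpow_const fun _ => Or.inr (by linarith)
  have hc2 : Continuous fun u : J 2 => stressForm p hp hp2 u u :=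
    (continuous_stressForm hp hp2).comp (f := fun u : J 2 => (u, u)) (by fun_prop)
  refine J_induction (P := fun u => ‖u.1.1‖ ^ p ≤ C * stressForm p hp hp2 u u) (isClosed_le hc1
    (continuous_const.mul hc2)) ?_ u
  intro Φ hΦ u h1 h2
  have hcs : Continuous fun x => symPart (grad Φ x) :=
    continuous_symPart.comp (continuous_grad hΦ.smooth)
  have hform : stressForm p hp hp2 u u = ∫ x, ‖symPart (grad Φ x)‖ ^ p ∂cubeMeasure := by
    rw [stressForm_eq]
    refine integral_congr_ae ?_
    filter_upwards [h2] with x b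
    rw [b, inner_stress_self hp]
  have hI : 0 ≤ ∫ x, ‖symPart (grad Φ x)‖ ^ p ∂cubeMeasure :=
    integral_nonneg fun x => by positivity
  have hS := hC.sobolev Φ hΦ
  rw [← eLpNorm_congr_ae h1, ← Lp.enorm_def, ← ofReal_norm,
    ENNReal.ofReal_rpow_of_nonneg (norm_nonneg _) (by linarith),
    (memLp_cube hcs _).eLpNorm_eq_integral_rpow_norm (by simp; linarith) (by simp),
    ENNReal.toReal_ofReal (by linarith), ENNReal.ofReal_rpow_of_nonneg (by positivity)
    (by linarith), ← Real.rpow_mul hI, inv_mul_cancel₀ (by linarith), Real.rpow_one,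
    ← ENNReal.ofReal_mul hC.pos.le, ENNReal.ofReal_le_ofReal_iff (mul_nonneg hC.pos.le hI)] at hS
  rw [hform]
  exact hS

theorem norm_le_mul_norm_grad {p C : ℝ} (hC : IsSobolevConstant p C) (u : J 2) :
    ‖u.1.1‖ ≤ C * ‖u.1.2‖ := by
  refine J_induction (P := fun u => ‖u.1.1‖ ≤ C * ‖u.1.2‖) (isClosed_le (by fun_prop)
    (by fun_prop)) ?_ u
  intro Φ hΦ u h1 h2
  have hS := hC.poincare Φ hΦ
  rw [← eLpNorm_congr_ae h1, ← eLpNorm_congr_ae h2, ← Lp.enorm_def, ← Lp.enorm_def, ← ofReal_norm,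
    ← ofReal_norm, ← ENNReal.ofReal_mul hC.pos.le,
    ENNReal.ofReal_le_ofReal_iff (mul_nonneg hC.pos.le (norm_nonneg _))] at hS
  exact hS

/-! ### Weak time derivatives and the energy equality -/

/-- A smooth function with compact support in an open interval and integral zero is the derivative
of such a function. -/
theorem exists_antideriv {a b : ℝ} {ζ : ℝ → ℝ} (hζ : ContDiff ℝ ∞ ζ) (hc : HasCompactSupport ζ)
    (hs : tsupport ζ ⊆ Ioo a b) (h0 : ∫ t, ζ t = 0) :
    ∃ Z : ℝ → ℝ, ContDiff ℝ ∞ Z ∧ HasCompactSupport Z ∧ tsupport Z ⊆ Ioo a b ∧ deriv Z = ζ := by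
  rcases (tsupport ζ).eq_empty_or_nonempty with he | hne
  · have hz : ζ = 0 := tsupport_eq_empty_iff.1 he
    exact ⟨0, contDiff_const, HasCompactSupport.zero, by simp [tsupport], by simp [hz]⟩
  have hK : IsCompact (tsupport ζ) := hc
  obtain ⟨c, hcm, hcl⟩ := hK.exists_isLeast hne
  obtain ⟨d, hdm, hdl⟩ := hK.exists_isGreatest hne
  have hac := (hs hcm).1
  have hdb := (hs hdm).2
  have hzero : ∀ t, t < c ∨ d < t → ζ t = 0 := by
    intro t ht
    refine image_eq_zero_of_notMem_tsupport fun hm => ?_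
    rcases ht with h | h
    · exact absurd (hcl hm) (not_le.2 h)
    · exact absurd (hdl hm) (not_le.2 h)
  have hder : ∀ t, HasDerivAt (fun t => ∫ s in a..t, ζ s) (ζ t) t := fun t =>
    hζ.continuous.integral_hasStrictDerivAt a t |>.hasDerivAt
  have hderiv : deriv (fun t => ∫ s in a..t, ζ s) = ζ := funext fun t => (hder t).deriv
  have hsupp : tsupport (fun t => ∫ s in a..t, ζ s) ⊆ Icc c d := by
    refine closure_minimal (fun t ht => ?_) isClosed_Icc
    by_contra hn
    refine ht ?_
    rw [mem_Icc, not_and_or, not_le, not_le] at hn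
    rcases hn with h | h
    · refine intervalIntegral.integral_zero_ae (.of_forall fun s hs => hzero s (.inl ?_))
      rcases Set.mem_uIoc.1 hs with h1 | h1
      · exact h1.2.trans_lt h
      · exact h1.2.trans_lt hac
    -- To the right of the support the primitive equals the full integral of `ζ`, which is zero.
    · have hsub : Function.support ζ ⊆ Ioc a t := fun s hs => by
        have h1 : c ≤ s := not_lt.1 fun hl => hs (hzero s (.inl hl))
        have h2 : s ≤ d := not_lt.1 fun hl => hs (hzero s (.inr hl))
        exact ⟨hac.trans_le h1, h2.trans h.le⟩
      change ∫ s in a..t, ζ s = 0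
      rw [intervalIntegral.integral_eq_integral_of_support_subset hsub, h0]
  refine ⟨_, ?_, isCompact_Icc.of_isClosed_subset (isClosed_tsupport _) hsupp,
    hsupp.trans (Icc_subset_Ioo hac hdb), hderiv⟩
  rw [contDiff_infty_iff_deriv, hderiv]
  exact ⟨fun t => (hder t).differentiableAt, hζ⟩

/-- A continuous function with a continuous weak derivative is differentiable. -/
theorem hasDerivAt_of_weak {a b : ℝ} {g h : ℝ → ℝ} (hg : Continuous g) (hh : Continuous h)
    (hw : ∀ η : ℝ → ℝ, ContDiff ℝ ∞ η → HasCompactSupport η → tsupport η ⊆ Ioo a b →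
      ∫ t, deriv η t * g t = -∫ t, η t * h t) {t : ℝ} (ht : t ∈ Ioo a b) :
    HasDerivAt g (h t) t := by
  let H : ℝ → ℝ := fun t => ∫ s in a..t, h s
  have hH : ∀ t, HasDerivAt H (h t) t := fun t =>
    hh.integral_hasStrictDerivAt a t |>.hasDerivAt
  have hHc : Continuous H := continuous_iff_continuousAt.2 fun t => (hH t).continuousAt
  let k : ℝ → ℝ := fun t => g t - H t
  have hk : Continuous k := hg.sub hHc
  have hint : ∀ {η f : ℝ → ℝ}, Continuous η → HasCompactSupport η → Continuous f →
      Integrable (fun t => η t * f t) := fun h1 h2 h3 =>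
    (h1.mul h3).integrable_of_hasCompactSupport h2.mul_right
  have hk0 : ∀ η : ℝ → ℝ, ContDiff ℝ ∞ η → HasCompactSupport η → tsupport η ⊆ Ioo a b →
      ∫ t, deriv η t * k t = 0 := by
    intro η h1 h2 h3
    have hdc : Continuous (deriv η) := h1.continuous_deriv (by simp)
    have hparts : ∫ t, η t * h t = -∫ t, deriv η t * H t :=
      integral_mul_deriv_eq_deriv_mul_of_integrable (u := η) (v := H)
        (fun t _ => (h1.differentiable (by simp) t).hasDerivAt) (fun t _ => hH t)
        (hint h1.continuous h2 hh) (hint hdc h2.deriv hHc) (hint h1.continuous h2 hHc)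
    have := hw η h1 h2 h3
    simp only [k, mul_sub]
    rw [integral_sub (hint hdc h2.deriv hg) (hint hdc h2.deriv hHc), this, hparts]
    ring
  obtain ⟨r, hr, hball⟩ := Metric.isOpen_iff.1 isOpen_Ioo t ht
  -- Du Bois-Reymond argument for `k`, whose weak derivative is zero: with a bump ρ of integral one,
  -- φ - (∫φ)ρ is the derivative of a test function, so `k` equals its ρ-average `m` almost
  -- everywhere, and everywhere on the interval by continuity.
  let B : ContDiffBump t := ⟨r / 4, r / 2, by linarith, by linarith⟩
  let ρ := B.normed volume
  have hρ1 : ContDiff ℝ ∞ ρ := B.contDiff_normed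
  have hρ2 : HasCompactSupport ρ := B.hasCompactSupport_normed
  have hρ3 : tsupport ρ ⊆ Ioo a b := by
    rw [B.tsupport_normed_eq]
    exact (Metric.closedBall_subset_ball (by simp only [B]; linarith)).trans hball
  have hρ4 : ∫ t, ρ t = 1 := B.integral_normed
  set m := ∫ t, ρ t * k t with hm
  have hzero : ∀ φ : ℝ → ℝ, ContDiff ℝ ∞ φ → HasCompactSupport φ → tsupport φ ⊆ Ioo a b →
      ∫ t, φ t • (k t - m) = 0 := by
    intro φ h1 h2 h3
    have hi := h1.continuous.integrable_of_hasCompactSupport h2 (μ := volume)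
    have hiρ := hρ1.continuous.integrable_of_hasCompactSupport hρ2 (μ := volume)
    let ζ : ℝ → ℝ := fun t => φ t - (∫ s, φ s) * ρ t
    have hζs : tsupport ζ ⊆ tsupport φ ∪ tsupport ρ := by
      refine closure_minimal (fun s hs => ?_) ((isClosed_tsupport _).union (isClosed_tsupport _))
      by_contra hn
      rw [mem_union, not_or] at hn
      refine hs ?_
      simp only [ζ]
      rw [image_eq_zero_of_notMem_tsupport hn.1, image_eq_zero_of_notMem_tsupport hn.2]
      ring
    obtain ⟨Z, hZ1, hZ2, hZ3, hZ4⟩ := exists_antideriv (a := a) (b := b) (ζ := ζ)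
      (h1.sub (contDiff_const.mul hρ1))
      ((IsCompact.union h2 hρ2).of_isClosed_subset (isClosed_tsupport _) hζs)
      (hζs.trans (union_subset h3 hρ3)) (by
        simp only [ζ]
        rw [integral_sub hi (hiρ.const_mul _), integral_const_mul, hρ4]; ring)
    have h4 := hk0 Z hZ1 hZ2 hZ3
    rw [hZ4] at h4
    have e1 : ∀ t, ζ t * k t = φ t * k t - (∫ s, φ s) * (ρ t * k t) := fun t => by
      simp only [ζ]; ring
    simp only [e1] at h4
    rw [integral_sub (hint h1.continuous h2 hk) ((hint hρ1.continuous hρ2 hk).const_mul _),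
      integral_const_mul, ← hm] at h4
    simp only [smul_eq_mul, mul_sub]
    rw [integral_sub (hint h1.continuous h2 hk) (hi.mul_const _), integral_mul_const]
    exact h4
  have hae := isOpen_Ioo.ae_eq_zero_of_integral_contDiff_smul_eq_zero (U := Ioo a b) (μ := volume)
    ((hk.sub continuous_const).locallyIntegrable.locallyIntegrableOn _) hzero
  have heq : EqOn k (fun _ => m) (Ioo a b) := by
    refine Measure.eqOn_open_of_ae_eq (μ := volume) ?_ isOpen_Ioo hk.continuousOn
      continuousOn_const
    rw [EventuallyEq, ae_restrict_iff' measurableSet_Ioo]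
    filter_upwards [hae] with s h1 h2
    exact sub_eq_zero.1 (h1 h2)
  have hgH : g =ᶠ[𝓝 t] fun s => H s + m := by
    filter_upwards [isOpen_Ioo.mem_nhds ht] with s hs
    have := heq hs
    simp only [k] at this
    linarith
  exact ((hH t).add_const m).congr_of_eventuallyEq hgH

/-- If `⟨u, ψ⟩` has the derivative `-F(u, ψ)` for each fixed `ψ`, then `‖u‖²` has the derivative
`-2 F(u, u)`. -/
theorem hasDerivAt_norm_sq {X E : Type*} [TopologicalSpace X] [NormedAddCommGroup E]
    [InnerProductSpace ℝ E] {π : X → E} {F : X × X → ℝ} (hF : Continuous F)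
    {u : ℝ → X} (hu : Continuous u) {a b : ℝ}
    (hd : ∀ ψ, ∀ t ∈ Ioo a b, HasDerivAt (fun s => inner ℝ (π (u s)) (π ψ)) (-F (u t, ψ)) t)
    {t : ℝ} (ht : t ∈ Ioo a b) :
    HasDerivAt (fun s => ‖π (u s)‖ ^ 2) (-(2 * F (u t, u t))) t := by
  -- The squared norm splits as ⟨u(s)-u(t), u(s)⟩ + ⟨u(s), u(t)⟩, each with derivative -F(u(t),
  -- u(t)) at s = t. For the first, freeze the test element u(s) and apply the mean value inequality
  -- between t and s; joint continuity of F keeps the derivative near -F(u(t), u(t)). No derivative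
  -- of `u` itself is needed.
  have h1 : HasDerivAt (fun s => inner ℝ (π (u s) - π (u t)) (π (u s))) (-F (u t, u t)) t := by
    rw [hasDerivAt_iff_isLittleO, Asymptotics.isLittleO_iff]
    intro ε hε
    have hG : Continuous fun z : ℝ × ℝ => F (u z.1, u z.2) :=
      hF.comp (f := fun z : ℝ × ℝ => (u z.1, u z.2)) (by fun_prop)
    obtain ⟨r, hr, hball⟩ := Metric.continuous_iff.1 hG (t, t) ε hε
    filter_upwards [Metric.ball_mem_nhds t hr, isOpen_Ioo.mem_nhds ht] with s hs hsI
    have hsub : uIcc t s ⊆ Ioo a b := (convex_Ioo a b).ordConnected.uIcc_subset ht hsI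
    have hder : ∀ τ ∈ uIcc t s, HasDerivWithinAt
        (fun τ => inner ℝ (π (u τ)) (π (u s)) + F (u t, u t) * τ)
        (-F (u τ, u s) + F (u t, u t)) (uIcc t s) τ := fun τ hτ => by
      have := ((hd (u s) τ (hsub hτ)).add ((hasDerivAt_id τ).const_mul (F (u t, u t))))
      simp only [mul_one] at this
      exact this.hasDerivWithinAt
    have hbound : ∀ τ ∈ uIcc t s, ‖-F (u τ, u s) + F (u t, u t)‖ ≤ ε := fun τ hτ => by
      have h2 : dist (τ, s) (t, t) < r := by
        rw [Prod.dist_eq, max_lt_iff]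
        refine ⟨lt_of_le_of_lt ?_ hs, hs⟩
        simp only [Real.dist_eq]
        exact abs_sub_left_of_mem_uIcc hτ
      have h3 := hball _ h2
      rw [Real.dist_eq, abs_sub_comm] at h3
      rw [neg_add_eq_sub, Real.norm_eq_abs]
      exact h3.le
    have key := Convex.norm_image_sub_le_of_norm_hasDerivWithin_le hder hbound (convex_uIcc t s)
      left_mem_uIcc right_mem_uIcc
    refine le_trans (le_of_eq ?_) key
    congr 1
    simp only [inner_sub_left, smul_eq_mul]
    ring
  have h2 := (hd (u t) t ht)
  have h3 := h1.add h2
  have h4 : (fun s => inner ℝ (π (u s) - π (u t)) (π (u s))) + (fun s => inner ℝ (π (u s)) (π (u t)))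
      = fun s => ‖π (u s)‖ ^ 2 := by
    ext s
    simp only [Pi.add_apply, inner_sub_left, real_inner_self_eq_norm_sq, real_inner_comm (π (u s))]
    ring
  rw [h4, ← two_mul, mul_neg] at h3
  exact h3

/-! ### The differential inequality -/

/-- Extinction for the differential inequality `y' ≤ -(2 / C) y ^ (p / 2)`. -/
theorem eq_zero_of_deriv_le {p C y₀ a b : ℝ} (hp2 : p < 2) (hC : 0 < C)
    {y y' : ℝ → ℝ} (hy : Continuous y) (hnn : ∀ t, 0 ≤ y t)
    (hd : ∀ t ∈ Ioo a b, HasDerivAt y (y' t) t)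
    (hle : ∀ t ∈ Ioo a b, C * y' t ≤ -(2 * y t ^ (p / 2))) (hy0 : y a ≤ y₀) {t : ℝ}
    (ht : t ∈ Icc (a + C * y₀ ^ ((2 - p) / 2) / (2 - p)) b) : y t = 0 := by
  by_contra hne
  have hpos : 0 < y t := (hnn t).lt_of_ne (Ne.symm hne)
  have hy00 : 0 ≤ y₀ := (hnn a).trans hy0
  have hp0 : 0 < 2 - p := by linarith
  have hat : a ≤ t := by
    have : 0 ≤ C * y₀ ^ ((2 - p) / 2) / (2 - p) := by positivity
    linarith [ht.1]
  have hsub : Ioo a t ⊆ Ioo a b := Ioo_subset_Ioo_right ht.2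
  have hanti : AntitoneOn y (Icc a t) := by
    refine antitoneOn_of_deriv_nonpos (convex_Icc a t) hy.continuousOn ?_ ?_ <;>
      rw [interior_Icc]
    · exact fun s hs => (hd s (hsub hs)).differentiableAt.differentiableWithinAt
    · intro s hs
      rw [(hd s (hsub hs)).deriv]
      have h1 := hle s (hsub hs)
      have h2 : 0 ≤ y s ^ (p / 2) := Real.rpow_nonneg (hnn s) _
      by_contra h3
      have : 0 < C * y' s := mul_pos hC (not_le.1 h3)
      linarith
  -- Positivity at `t` propagates backwards by monotonicity, so the power (2-p)/2 < 1 of `y` is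
  -- differentiable on the whole interval.
  have hys : ∀ s ∈ Icc a t, 0 < y s := fun s hs =>
    hpos.trans_le (hanti hs ⟨hat, le_rfl⟩ hs.2)
  -- The inequality says that y^((2-p)/2) falls with slope at most -(2-p)/C, that is, z is
  -- nonincreasing.
  let z : ℝ → ℝ := fun s => y s ^ ((2 - p) / 2) + (2 - p) / C * s
  have hz : AntitoneOn z (Icc a t) := by
    refine antitoneOn_of_deriv_nonpos (convex_Icc a t) ?_ ?_ ?_
    · exact ((hy.rpow_const fun _ => Or.inr (by linarith)).add
        (continuous_const.mul continuous_id)).continuousOn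
    all_goals rw [interior_Icc]
    · intro s hs
      exact (((hd s (hsub hs)).rpow_const (Or.inl (hys s (Ioo_subset_Icc_self hs)).ne')).add
        ((hasDerivAt_id s).const_mul _)).differentiableAt.differentiableWithinAt
    · intro s hs
      have h0 := hys s (Ioo_subset_Icc_self hs)
      have h1 : HasDerivAt z _ s :=
        ((hd s (hsub hs)).rpow_const (p := (2 - p) / 2) (Or.inl h0.ne')).add
        ((hasDerivAt_id s).const_mul ((2 - p) / C))
      rw [h1.deriv]
      have h2 := hle s (hsub hs)
      have h3 : y s ^ ((2 - p) / 2 - 1) * y s ^ (p / 2) = 1 := by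
        rw [← Real.rpow_add h0]; ring_nf; simp
      have h4 : 0 < y s ^ ((2 - p) / 2 - 1) := by positivity
      have h5 : C * (y' s * ((2 - p) / 2) * y s ^ ((2 - p) / 2 - 1) + (2 - p) / C * 1) ≤ 0 := by
        have h6 : C * ((2 - p) / C) = 2 - p := by field_simp
        have h7 : C * y' s * ((2 - p) / 2 * y s ^ ((2 - p) / 2 - 1)) ≤
            -(2 * y s ^ (p / 2)) * ((2 - p) / 2 * y s ^ ((2 - p) / 2 - 1)) := by gcongr
        linear_combination h7 + h6 - (2 - p) * h3
      by_contra h6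
      exact absurd (mul_pos hC (not_le.1 h6)) (not_lt.2 h5)
  have hfin := hz ⟨le_rfl, hat⟩ ⟨hat, le_rfl⟩ hat
  simp only [z] at hfin
  have h1 : y a ^ ((2 - p) / 2) ≤ y₀ ^ ((2 - p) / 2) :=
    Real.rpow_le_rpow (hnn a) hy0 (by linarith)
  have h2 : 0 < y t ^ ((2 - p) / 2) := by positivity
  have h3 : y₀ ^ ((2 - p) / 2) ≤ (2 - p) / C * (t - a) := by
    have h4 : C * y₀ ^ ((2 - p) / 2) / (2 - p) ≤ t - a := by linarith [ht.1]
    calc y₀ ^ ((2 - p) / 2) = (2 - p) / C * (C * y₀ ^ ((2 - p) / 2) / (2 - p)) := by field_simp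
      _ ≤ _ := by gcongr
  linarith

/-! ### Extinction of the solution -/

/-- The inclusion of `L²` in `L^q`, `q ≤ 2`. -/
def lpIncl {E : Type*} [NormedAddCommGroup E] {q : ℝ≥0∞} (hq : q ≤ 2) (f : Lp E 2 cubeMeasure) :
    Lp E q cubeMeasure := ((Lp.memLp f).mono_exponent hq).toLp

theorem coeFn_lpIncl {E : Type*} [NormedAddCommGroup E] {q : ℝ≥0∞} (hq : q ≤ 2)
    (f : Lp E 2 cubeMeasure) : lpIncl hq f =ᵐ[cubeMeasure] f := MemLp.coeFn_toLp _

theorem continuous_lpIncl {E : Type*} [NormedAddCommGroup E] {q : ℝ≥0∞} [Fact (1 ≤ q)]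
    (hq : q ≤ 2) : Continuous (lpIncl (E := E) hq) := by
  have h : LipschitzWith 1 (lpIncl (E := E) hq) := by
    intro f g
    rw [lpIncl, lpIncl, Lp.edist_toLp_toLp, Lp.edist_def, ENNReal.coe_one, one_mul]
    exact eLpNorm_le_eLpNorm_of_exponent_le hq
      ((Lp.aestronglyMeasurable f).sub (Lp.aestronglyMeasurable g))
  exact h.continuous

/-- The equation admits test fields in J^(1,p), while the energy method tests with elements of
J^(1,2); the inclusion holds because p ≤ 2 and the cube has finite measure. -/
theorem exists_mem_J {q : ℝ≥0∞} [Fact (1 ≤ q)] (hq : q ≤ 2) {u : W 2} (hu : u ∈ J 2) :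
    ∃ w ∈ J q, w.1 =ᵐ[cubeMeasure] u.1 ∧ w.2 =ᵐ[cubeMeasure] u.2 := by
  refine ⟨(lpIncl hq u.1, lpIncl hq u.2), ?_, coeFn_lpIncl hq _, coeFn_lpIncl hq _⟩
  refine map_mem_closure (f := fun u : W 2 => (lpIncl hq u.1, lpIncl hq u.2)) ?_ hu ?_
  · exact ((continuous_lpIncl hq).comp continuous_fst).prodMk
      ((continuous_lpIncl hq).comp continuous_snd)
  · rintro w ⟨Φ, hΦ, h1, h2⟩
    exact ⟨Φ, hΦ, (coeFn_lpIncl hq _).trans h1, (coeFn_lpIncl hq _).trans h2⟩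

/-- The solution tested with a fixed field, on an interval where the force vanishes. -/
theorem IsSolutionOn.hasDerivAt_inner {p : ℝ} [hp : Fact (p ∈ Ico (5 / 3 : ℝ) 2)] (hp1 : 1 < p)
    (hp2 : p < 2) {T a : ℝ} {f : ℝ → Lp V (ENNReal.ofReal (4 / p)) cubeMeasure} {v₀ : W 2}
    {v : ℝ → W 2} (hv : IsSolutionOn p T f v₀ v) (ha : 0 ≤ a)
    (hf : ∀ᵐ t ∂volume.restrict (Icc a T), ‖f t‖ = 0) {u : ℝ → J 2} (hu : Continuous u)
    (huv : ∀ t ∈ Icc 0 T, (u t).1 = v t) (ψ : J 2) {t : ℝ} (ht : t ∈ Ioo a T) :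
    HasDerivAt (fun s => inner ℝ (u s).1.1 ψ.1.1)
      (-(convectForm (u t) ψ + stressForm p hp1 hp2 (u t) ψ)) t := by
  obtain ⟨w, hwL, hwd, hweq⟩ := hv.equation
  have hq : ENNReal.ofReal p ≤ 2 := by
    rw [show (2 : ℝ≥0∞) = ENNReal.ofReal 2 by simp]
    exact ENNReal.ofReal_le_ofReal hp2.le
  obtain ⟨ψ', hψ', hψ1, hψ2⟩ := exists_mem_J hq ψ.2
  have hg : Continuous fun s => (inner ℝ (u s).1.1 ψ.1.1 : ℝ) :=
    (continuous_fst.comp (continuous_subtype_val.comp hu)).inner continuous_const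
  have hF : Continuous fun s => -(convectForm (u s) ψ + stressForm p hp1 hp2 (u s) ψ) :=
    ((continuous_convectForm.comp (f := fun s => (u s, ψ)) (by fun_prop)).add
      ((continuous_stressForm hp1 hp2).comp (f := fun s => (u s, ψ)) (by fun_prop))).neg
  have heq : ∀ᵐ s ∂volume.restrict (Ioo a T), (inner ℝ (w s) ψ.1.1 : ℝ) =
      -(convectForm (u s) ψ + stressForm p hp1 hp2 (u s) ψ) := by
    have h1 := ae_restrict_of_ae_restrict_of_subset (Ioo_subset_Ioo_left ha) (hweq ψ' hψ')
    have h2 := ae_restrict_of_ae_restrict_of_subset Ioo_subset_Icc_self hf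
    filter_upwards [h1, h2, ae_restrict_mem measurableSet_Ioo] with s e1 e2 hs
    have hus := huv s ⟨ha.trans hs.1.le, hs.2.le⟩
    have i1 : ∫ x, inner ℝ (w s x) (ψ'.1 x) ∂cubeMeasure = inner ℝ (w s) ψ.1.1 := by
      rw [L2.inner_def]
      refine integral_congr_ae ?_
      filter_upwards [hψ1] with x hx
      rw [hx]
    have i2 : ∫ x, inner ℝ (convect ((v s).1 x) ((v s).2 x)) (ψ'.1 x) ∂cubeMeasure
        = convectForm (u s) ψ := by
      rw [convectForm_eq, hus]
      refine integral_congr_ae ?_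
      filter_upwards [hψ1] with x hx
      rw [hx]
    have i3 : ∫ x, inner ℝ (stress p (symPart ((v s).2 x))) (symPart (ψ'.2 x)) ∂cubeMeasure
        = stressForm p hp1 hp2 (u s) ψ := by
      rw [stressForm_eq, hus]
      refine integral_congr_ae ?_
      filter_upwards [hψ2] with x hx
      rw [hx]
    have i4 : ∫ x, inner ℝ (f s x) (ψ'.1 x) ∂cubeMeasure = 0 := by
      have h0 : f s =ᵐ[cubeMeasure] 0 := by
        rw [norm_eq_zero.1 e2]; exact Lp.coeFn_zero _ _ _
      rw [← integral_zero V ℝ (μ := cubeMeasure)]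
      refine integral_congr_ae ?_
      filter_upwards [h0] with x hx
      rw [hx]; simp
    rw [i1, i2, i3, i4] at e1
    linarith
  -- The pairing and the forms are continuous in time, so the equation, known only almost everywhere
  -- with a null set depending on ψ, gives a derivative at every time.
  refine hasDerivAt_of_weak (a := a) (b := T) hg hF (fun η h1 h2 h3 => ?_) ht
  have hsub : Ioo a T ⊆ Ioo 0 T := Ioo_subset_Ioo_left ha
  have hη : ∀ s, s ∉ Ioo a T → η s = 0 := fun s hs =>
    image_eq_zero_of_notMem_tsupport fun hm => hs (h3 hm)
  have hη' : ∀ s, s ∉ Ioo a T → deriv η s = 0 := fun s hs =>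
    image_eq_zero_of_notMem_tsupport fun hm => hs (h3 (tsupport_deriv_subset hm))
  have key := congrArg (fun z => inner ℝ ψ.1.1 z) (hwd η h1 h2 (h3.trans hsub))
  have hi1 : Integrable (fun s => deriv η s • (v s).1) (volume.restrict (Ioo 0 T)) := by
    have hc : Continuous fun s => deriv η s • (u s).1.1 :=
      (h1.continuous_deriv (by simp)).smul (continuous_fst.comp (continuous_subtype_val.comp hu))
    refine ((hc.integrableOn_Icc (a := 0) (b := T)).mono_set Ioo_subset_Icc_self).congr ?_
    filter_upwards [ae_restrict_mem measurableSet_Ioo] with s hs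
    rw [huv s (Ioo_subset_Icc_self hs)]
  have hi2 : Integrable (fun s => η s • w s) (volume.restrict (Ioo 0 T)) := by
    obtain ⟨B, hB⟩ := h2.exists_bound_of_continuous h1.continuous
    exact (hwL.integrable (by norm_num)).bdd_smul B h1.continuous.aestronglyMeasurable
      (.of_forall hB)
  simp only [inner_neg_right, ← integral_inner hi1, ← integral_inner hi2] at key
  simp only [real_inner_smul_right] at key
  have l1 : ∫ s in Ioo 0 T, deriv η s * inner ℝ ψ.1.1 (v s).1 =
      ∫ s, deriv η s * inner ℝ (u s).1.1 ψ.1.1 := by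
    refine Eq.trans ?_ (setIntegral_eq_integral_of_forall_compl_eq_zero (s := Ioo 0 T)
      fun s hs => by rw [hη' s fun h => hs (hsub h), zero_mul])
    refine setIntegral_congr_fun measurableSet_Ioo fun s hs => ?_
    rw [huv s (Ioo_subset_Icc_self hs), real_inner_comm]
  have l2 : ∫ s in Ioo 0 T, η s * inner ℝ ψ.1.1 (w s) =
      ∫ s, η s * -(convectForm (u s) ψ + stressForm p hp1 hp2 (u s) ψ) := by
    refine Eq.trans ?_ (setIntegral_eq_integral_of_forall_compl_eq_zero (s := Ioo 0 T)
      fun s hs => by rw [hη s fun h => hs (hsub h), zero_mul])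
    refine setIntegral_congr_ae measurableSet_Ioo ?_
    filter_upwards [(ae_restrict_iff' measurableSet_Ioo).1 heq] with s h4 _
    by_cases hs : s ∈ Ioo a T
    · rw [← h4 hs, real_inner_comm]
    · rw [hη s hs, zero_mul, zero_mul]
  rw [l1, l2] at key
  exact key

/-- Extinction in finite time once the force vanishes. -/
theorem IsSolutionOn.norm_eq_zero {p : ℝ} [hp : Fact (p ∈ Ico (5 / 3 : ℝ) 2)] {T a C L : ℝ}
    {f : ℝ → Lp V (ENNReal.ofReal (4 / p)) cubeMeasure} {v₀ : W 2}
    {v : ℝ → W 2} (hv : IsSolutionOn p T f v₀ v) (hC : IsSobolevConstant p C)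
    (ha : a ∈ Ico 0 T) (hf : ∀ᵐ t ∂volume.restrict (Icc a T), ‖f t‖ = 0)
    (hL : ‖(v a).2‖ ^ 2 ≤ L) {t : ℝ}
    (ht : t ∈ Icc (a + C ^ (3 - p) * L ^ ((2 - p) / 2) / (2 - p)) T) : ‖(v t).1‖ = 0 := by
  have hp1 : 1 < p := by linarith [hp.out.1]
  have hp2 : p < 2 := hp.out.2
  have hL0 : 0 ≤ L := (sq_nonneg _).trans hL
  have hT : 0 ≤ T := ha.1.trans ha.2.le
  -- Freezing time outside [0,T] makes the solution a continuous curve in J^(1,2) on the whole line.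
  let u : ℝ → J 2 := fun t => ⟨v (projIcc 0 T hT t), hv.mem _ (projIcc 0 T hT t).2⟩
  have hu : Continuous u :=
    Continuous.subtype_mk ((continuousOn_iff_continuous_domRestrict.1 hv.continuousOn).comp
      continuous_projIcc) _
  have huv : ∀ t ∈ Icc 0 T, (u t).1 = v t := fun t ht => by
    simp only [u, projIcc_of_mem hT ht]
  let F : J 2 × J 2 → ℝ := fun z => convectForm z.1 z.2 + stressForm p hp1 hp2 z.1 z.2
  have hF : Continuous F := continuous_convectForm.add (continuous_stressForm hp1 hp2)
  have hd := fun t (ht : t ∈ Ioo a T) => hasDerivAt_norm_sq (π := fun w : J 2 => w.1.1) hF hu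
    (fun ψ t ht => hv.hasDerivAt_inner hp1 hp2 ha.1 hf hu huv ψ ht) ht
  have hmem : t ∈ Icc 0 T := by
    refine ⟨?_, ht.2⟩
    have h1 : 0 ≤ C ^ (3 - p) * L ^ ((2 - p) / 2) / (2 - p) :=
      div_nonneg (mul_nonneg (Real.rpow_nonneg hC.pos.le _) (Real.rpow_nonneg hL0 _))
        (by linarith)
    linarith [ht.1, ha.1]
  have hCp := hC.pos
  have htime : C * (C ^ 2 * L) ^ ((2 - p) / 2) / (2 - p)
      = C ^ (3 - p) * L ^ ((2 - p) / 2) / (2 - p) := by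
    rw [Real.mul_rpow (by positivity) hL0, ← Real.rpow_natCast_mul hCp.le, ← mul_assoc]
    nth_rewrite 1 [← Real.rpow_one C]
    rw [← Real.rpow_add hCp]
    congr 3
    push_cast; ring
  have hy : Continuous fun s => ‖(u s).1.1‖ ^ 2 :=
    (continuous_fst.comp (continuous_subtype_val.comp hu)).norm.pow 2
  -- The initial bound C²L is the squared Poincaré inequality at time `a`; its power (2-p)/2
  -- contributes C^(2-p), whence the exponent 3-p.
  have hzero := eq_zero_of_deriv_le (p := p) (C := C) (y₀ := C ^ 2 * L) (a := a) (b := T)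
    hp2 hCp hy (fun _ => by positivity) hd (fun s _ => ?_) ?_ (t := t) (by rwa [htime])
  · rw [huv t hmem] at hzero
    exact pow_eq_zero_iff two_ne_zero |>.1 hzero
  · have h1 := norm_rpow_le_stressForm hp1 hp2 hC (u s)
    simp only [F, convectForm_self, zero_add]
    rw [← Real.rpow_natCast_mul (norm_nonneg _), show ((2 : ℕ) : ℝ) * (p / 2) = p by push_cast; ring]
    linarith
  · have h1 := norm_le_mul_norm_grad hC (u a)
    have h2 : (u a).1 = v a := huv a ⟨ha.1, ha.2.le⟩
    rw [h2] at h1 ⊢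
    calc ‖(v a).1‖ ^ 2 ≤ (C * ‖(v a).2‖) ^ 2 := by gcongr
      _ = C ^ 2 * ‖(v a).2‖ ^ 2 := by ring
      _ ≤ _ := by gcongr

end PNavierStokes
end

open PNavierStokes
theorem theorem3 (p : ℝ) [Fact (p ∈ Set.Ico (5 / 3 : ℝ) 2)] :
    (∃ C_S : ℝ, IsSobolevConstant p C_S) ∧
    ∀ C_S C_K Λ K : ℝ, IsSobolevConstant p C_S → 0 < C_K → IsSmall p C_S C_K Λ K →
    ∀ (𝒯 t_f : ℝ) (f : ℝ → Lp V (ENNReal.ofReal (4 / p)) cubeMeasure) (v₀ : W 2) (v : ℝ → W 2),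
      -- the assumptions on the force
      MemLp f ∞ (volume.restrict (Set.Ioi 0)) →
      (∀ᵐ t ∂volume.restrict (Set.Ioi (0 : ℝ)), ‖f t‖ ≤ K) →
      IsTimePeriodic 𝒯 f →
      -- the time-periodic solution
      (∀ T : ℝ, 0 < T → IsSolutionOn p T f v₀ v) →
      IsTimePeriodic 𝒯 v →
      (∀ t ∈ Set.Icc 0 𝒯, ‖(v t).2‖ ^ 2 ≤ Λ) →
      -- the extinction instant of the force
      t_f ∈ Set.Ioo 0 𝒯 →
      (∀ᵐ t ∂volume.restrict (Set.Icc t_f 𝒯), ‖f t‖ = 0) →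
      t_f + C_S ^ (3 - p) * Λ ^ ((2 - p) / 2) / (2 - p) < 𝒯 →
      ∃ t_bar : ℝ, t_f ≤ t_bar ∧
        t_bar ≤ t_f + C_S ^ (3 - p) * Λ ^ ((2 - p) / 2) / (2 - p) ∧
        ∀ t ∈ Set.Icc t_bar 𝒯, ‖(v t).1‖ = 0 := by
  have hp : p ∈ Set.Ico (5 / 3 : ℝ) 2 := Fact.out
  refine ⟨exists_isSobolevConstant hp, ?_⟩
  intro C_S C_K Λ K hC _ hsmall 𝒯 t_f f v₀ v _ _ _ hv _ hΛ htf hf _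
  -- The witness is the right end of the admissible window, by which the energy has vanished for any
  -- solution within the gradient bound.
  refine ⟨_, ?_, le_rfl, fun t ht => ?_⟩
  · have h1 : 0 ≤ C_S ^ (3 - p) * Λ ^ ((2 - p) / 2) / (2 - p) :=
      div_nonneg (mul_nonneg (Real.rpow_nonneg hC.pos.le _) (Real.rpow_nonneg hsmall.Λ_pos.le _))
        (by linarith [hp.2])
    linarith
  · exact (hv 𝒯 (htf.1.trans htf.2)).norm_eq_zero hC ⟨htf.1.le, htf.2⟩ hf
      (hΛ t_f ⟨htf.1.le, htf.2.le⟩) ht
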